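/- There are absolute constants $c,c'>0$ such that the following holds. Let $d\ge 2$, let $x_1,\dots,x_n\in\mathbb{R}^d$ be deterministic vectors, let $\sigma>0$ be defined by $\frac1n\sum_{i=1}^n|x_i|^2=\sigma^2 d$, and suppose that $A,B\in\mathbb{R}$ satisfy $$\frac1n\sum_{i=1}^n\bigl|\sigma^{-2}|x_i|^2-d\bigr|\le A,\qquad \frac1n\sum_{i=1}^n\langle\theta,x_i\rangle^2\le B\ \text{ for all }\theta\in\mathbb{S}^{d-1}.$$ For $\theta\in\mathbb{S}^{d-1}$ let $\mu_n^\theta=\frac1n\sum_{i=1}^n\delta_{\langle\theta,x_i\rangle}$, and let $d_{BL}(\mu,\nu)=\sup\{|\int f\,d\mu-\int f\,d\nu| : \|f\|_{BL}\le 1\}$, where $\|f\|_{BL}=\|f\|_\infty+\sup_{x\ne y}\frac{|f(x)-f(y)|}{|x-y|}$, be the bounded-Lipschitz distance of probability measures on $\mathbb{R}$. Let $\epsilon\ge\frac{2(A+2)}{d-1}$, let $\theta_1,\theta_2,\dots$ be independent uniformly distributed random points of $\mathbb{S}^{d-1}$, and let $T_\epsilon=\min\{j\ge1: d_{BL}(\mu_n^{\theta_j},\mathcal{N}(0,\sigma^2))>\epsilon\}$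 (with $\min\emptyset=\infty$). Then $$\mathbb{E}\,T_\epsilon\ \ge\ \frac{c\,\epsilon^{3/2}}{\sqrt B}\exp\left(\frac{c'(d-1)\epsilon^5}{B^2}\right).$$ -/

import Mathlib

open MeasureTheory ProbabilityTheory
open scoped ENNReal NNReal

noncomputable section

/-- The unit sphere `𝕊^{d-1}` of Euclidean space `ℝ^d`. -/
abbrev UnitSphere (d : ℕ) : Type :=
  Metric.sphere (0 : EuclideanSpace ℝ (Fin d)) 1

/-- The uniform distribution on the unit sphere: normalised surface measure. -/
def uniformSphere (d : ℕ) : Measure (UnitSphere d) :=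
  ((volume : Measure (EuclideanSpace ℝ (Fin d))).toSphere Set.univ)⁻¹ •
    (volume : Measure (EuclideanSpace ℝ (Fin d))).toSphere

/-- The measure with mass `1/n` at each of the points `⟨θ, x₁⟩, …, ⟨θ, xₙ⟩`
(counted with multiplicity). -/
def projMeasure {n d : ℕ} (x : Fin n → EuclideanSpace ℝ (Fin d))
    (θ : EuclideanSpace ℝ (Fin d)) : Measure ℝ :=
  (n : ℝ≥0∞)⁻¹ • ∑ i, Measure.dirac (inner ℝ θ (x i))

/-- The bounded-Lipschitz norm `sup_x |f x| + sup_{x ≠ y} |f x - f y| / |x - y|`,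
with value `∞` allowed. -/
def blNorm (f : ℝ → ℝ) : ℝ≥0∞ :=
  (⨆ x : ℝ, ENNReal.ofReal |f x|) +
    ⨆ (x : ℝ) (y : ℝ) (_ : x ≠ y), ENNReal.ofReal (|f x - f y| / |x - y|)

/-- The bounded-Lipschitz distance of two (probability) measures on the line. -/
def dBL (μ ν : Measure ℝ) : ℝ≥0∞ :=
  ⨆ (f : ℝ → ℝ) (_ : blNorm f ≤ 1), ENNReal.ofReal |∫ t, f t ∂μ - ∫ t, f t ∂ν|

/-- The first (one-based) index `j` whose direction `θ_j` gives a projection at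
bounded-Lipschitz distance more than `ε` from `N(0, σ²)`, and `∞` if there is none.
The sequence `θ₁, θ₂, …` is `θ 0, θ 1, …`. -/
def waitingTime {n d : ℕ} (x : Fin n → EuclideanSpace ℝ (Fin d)) (σ ε : ℝ)
    (θ : ℕ → UnitSphere d) : ℕ∞ :=
  sInf {t : ℕ∞ | ∃ j : ℕ, t = ((j + 1 : ℕ) : ℕ∞) ∧
    ENNReal.ofReal ε < dBL (projMeasure x (θ j)) (gaussianReal 0 (σ ^ 2).toNNReal)}

end

/-! ### Gaussian vectors: marginals, exponential moments, length and direction. -/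

section GaussianVector

variable {E : Type*} [NormedAddCommGroup E] [InnerProductSpace ℝ E] [FiniteDimensional ℝ E]
  [MeasurableSpace E] [BorelSpace E]

/-! Let `q`, of order √B ε^(-3/2) exp(-c'dε⁵/B²), bound the probability that one direction is bad. A
union bound over about 1/(2q) directions makes the expected waiting time at least 1/(4q)
(`le_lintegral_waitingTime`), so everything rests on the bound for `q` (`uniformSphere_dBL_gt_le`).

A uniform direction θ is replaced by a standard Gaussian vector g with that direction, and x_i by
y_i = x_i/√d. Then ⟨g, y_i⟩ = c⟨θ, x_i⟩ with c = ‖g‖/√d, which is close to 1 with high probability.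
Averaged over g, the empirical law of the ⟨g, y_i⟩ is the mixture of the N(0, ‖y_i‖²), and on test
functions bounded by 1 it differs from N(0, σ²) by at most 3A/(2d)
(`abs_integral_mean_sub_gaussianReal_le`). For one C¹ test function of slope at most K, the
empirical mean is a Lipschitz function of g with constant K√(B/d), so it has Gaussian tails around
its expectation (`lintegral_exp_sub_stdGaussian_le`, `stdGaussian_mean_tail`).

Uniformity over all bounded Lipschitz f comes from interpolating each f on [-R, R] by the same N
smooth steps: if these N test functions behave, every f does (`abs_mean_sub_integral_le`). With R ~
√(B/ε) and N ~ R/ε the union bound over steps costs √B ε^(-3/2), and a deviation ε/R at slope 1/ε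
gives the exponent dε⁵/B². -/

theorem stdGaussian_map_inner (w : E) :
    (stdGaussian E).map (fun x => inner ℝ x w) = gaussianReal 0 (‖w‖ ^ 2).toNNReal := by
  have h := IsGaussian.map_eq_gaussianReal (μ := stdGaussian E) (innerSL ℝ w)
  rw [integral_strongDual_stdGaussian, variance_dual_stdGaussian, innerSL_apply_norm] at h
  rw [← h]
  congr 1
  ext x
  simp [real_inner_comm]

theorem lintegral_exp_inner_stdGaussian (w : E) :
    ∫⁻ x, ENNReal.ofReal (Real.exp (inner ℝ x w)) ∂(stdGaussian E)
      = ENNReal.ofReal (Real.exp (‖w‖ ^ 2 / 2)) := by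
  have h := lintegral_map (μ := stdGaussian E) (f := fun t : ℝ => ENNReal.ofReal (Real.exp t))
    (g := fun x => inner ℝ x w) (by fun_prop) (by fun_prop)
  rw [← h, stdGaussian_map_inner, ← ofReal_integral_eq_lintegral_ofReal]
  · have := congrFun (mgf_fun_id_gaussianReal (μ := 0) (v := (‖w‖ ^ 2).toNNReal)) 1
    simp only [mgf, one_mul] at this
    rw [this]
    congr 2
    rw [Real.coe_toNNReal _ (by positivity)]
    ring
  · simpa using integrable_exp_mul_gaussianReal (μ := 0) (v := (‖w‖ ^ 2).toNNReal) 1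
  · filter_upwards with x using (Real.exp_pos _).le

theorem integral_sq_gaussianReal (v : ℝ≥0) : ∫ t, t ^ 2 ∂(gaussianReal 0 v) = v := by
  have h := variance_fun_id_gaussianReal (μ := 0) (v := v)
  rw [variance_of_integral_eq_zero (by fun_prop) (by simp)] at h
  simpa using h

theorem integrable_sq_gaussianReal (v : ℝ≥0) : Integrable (fun t => t ^ 2) (gaussianReal 0 v) := by
  simpa using (memLp_id_gaussianReal (μ := 0) (v := v) 2).integrable_sq

open Real in
/-- The density of the standard Gaussian measure. -/
theorem stdGaussian_eq_withDensity :
    stdGaussian E = (volume : Measure E).withDensity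
      (fun x => ENNReal.ofReal ((2 * π) ^ (-(Module.finrank ℝ E : ℝ) / 2) *
        Real.exp (-(1 / 2) * ‖x‖ ^ 2))) := by
  set c : ℝ := (2 * π) ^ (-(Module.finrank ℝ E : ℝ) / 2) with hc
  have hcpos : 0 < c := by positivity
  have hint := GaussianFourier.integral_rexp_neg_mul_sq_norm (V := E) (b := 1 / 2) (by norm_num)
  have h2 : c * (2 * π) ^ (Module.finrank ℝ E / 2 : ℝ) = 1 := by
    rw [hc, ← Real.rpow_add (by positivity)]
    simp [neg_div]
  have hpi : π / (1 / 2) = 2 * π := by ring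
  rw [hpi] at hint
  -- The integral of a non-integrable function is 0 by convention, while this one has a positive
  -- value.
  have hI : Integrable (fun x : E => Real.exp (-(1 / 2) * ‖x‖ ^ 2)) := by
    by_contra h
    rw [integral_undef h] at hint
    have : (0 : ℝ) < (2 * π) ^ (Module.finrank ℝ E / 2 : ℝ) := by positivity
    linarith
  have hfin : IsFiniteMeasure ((volume : Measure E).withDensity
      (fun x => ENNReal.ofReal (c * Real.exp (-(1 / 2) * ‖x‖ ^ 2)))) :=
    isFiniteMeasure_withDensity_ofReal (hI.const_mul c).2
  refine Measure.ext_of_charFun ?_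
  ext t
  rw [charFun_stdGaussian, charFun_apply, integral_withDensity_eq_integral_toReal_smul (by fun_prop)
    (by simp)]
  have hF := GaussianFourier.integral_cexp_neg_mul_sq_norm_add (V := E) (b := 1 / 2) (by norm_num)
    Complex.I t
  have e1 : ∀ x : E, (ENNReal.ofReal (c * Real.exp (-(1 / 2) * ‖x‖ ^ 2))).toReal •
      Complex.exp (inner ℝ x t * Complex.I) =
      (c : ℂ) * Complex.exp (-(1 / 2) * ‖x‖ ^ 2 + Complex.I * inner ℝ t x) := by
    intro x
    rw [ENNReal.toReal_ofReal (by positivity), Complex.real_smul, Complex.exp_add]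
    push_cast
    rw [real_inner_comm, mul_assoc, mul_comm Complex.I]
  simp_rw [e1]
  rw [integral_const_mul, hF, ← mul_assoc]
  have h3 : (c : ℂ) * (π / (1 / 2) : ℂ) ^ (Module.finrank ℝ E / 2 : ℂ) = 1 := by
    have : (π / (1 / 2) : ℂ) = ((2 * π : ℝ) : ℂ) := by push_cast; ring
    rw [this]
    have := congrArg (fun r : ℝ => (r : ℂ)) h2
    simp only [Complex.ofReal_mul c, Complex.ofReal_cpow (show (0 : ℝ) ≤ 2 * π by positivity)] at this
    simpa using this
  rw [h3, one_mul]
  congr 1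
  simp
  ring

open Real in
theorem lintegral_exp_sq_norm_stdGaussian {l : ℝ} (hl : l < 1 / 2) :
    ∫⁻ x, ENNReal.ofReal (Real.exp (l * ‖x‖ ^ 2)) ∂(stdGaussian E)
      = ENNReal.ofReal ((1 - 2 * l) ^ (-(Module.finrank ℝ E : ℝ) / 2)) := by
  have hb : 0 < 1 / 2 - l := by linarith
  have hint := GaussianFourier.integral_rexp_neg_mul_sq_norm (V := E) hb
  have hI : Integrable (fun x : E => Real.exp (-(1 / 2 - l) * ‖x‖ ^ 2)) := by
    by_contra h
    rw [integral_undef h] at hint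
    have : (0 : ℝ) < (π / (1 / 2 - l)) ^ (Module.finrank ℝ E / 2 : ℝ) := by positivity
    linarith
  rw [stdGaussian_eq_withDensity, lintegral_withDensity_eq_lintegral_mul _ (by fun_prop)
    (by fun_prop)]
  set c : ℝ := (2 * π) ^ (-(Module.finrank ℝ E : ℝ) / 2) with hc
  have hcpos : 0 < c := by positivity
  have e1 : ∀ x : E, ENNReal.ofReal (c * Real.exp (-(1 / 2) * ‖x‖ ^ 2)) *
      ENNReal.ofReal (Real.exp (l * ‖x‖ ^ 2)) =
      ENNReal.ofReal (c * Real.exp (-(1 / 2 - l) * ‖x‖ ^ 2)) := by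
    intro x
    rw [← ENNReal.ofReal_mul (by positivity), mul_assoc, ← Real.exp_add]
    ring_nf
  simp_rw [Pi.mul_apply, e1]
  rw [← ofReal_integral_eq_lintegral_ofReal (hI.const_mul c)
    (by filter_upwards with x using by positivity), integral_const_mul, hint]
  congr 1
  have : π / (1 / 2 - l) = (2 * π) * (1 - 2 * l)⁻¹ := by
    field_simp
  rw [this, Real.mul_rpow (by positivity) (by rw [inv_nonneg]; linarith), ← mul_assoc, hc,
    ← Real.rpow_add (by positivity)]
  have h0 : -(Module.finrank ℝ E : ℝ) / 2 + (Module.finrank ℝ E : ℝ) / 2 = 0 := by ring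
  rw [h0, Real.rpow_zero, one_mul, Real.inv_rpow (by linarith), ← Real.rpow_neg (by linarith),
    neg_div]

/-- Chernoff's bound with exponent s/8. The sign of `s` selects the tail: upper for s > 0, lower for
s < 0. -/
theorem stdGaussian_norm_sq_tail {s : ℝ} (hs : |s| ≤ 1) :
    stdGaussian E {x | s / 8 * (Module.finrank ℝ E * (1 + s)) ≤ s / 8 * ‖x‖ ^ 2} ≤
      ENNReal.ofReal (Real.exp (-(Module.finrank ℝ E * s ^ 2 / 16))) := by
  set m : ℝ := (Module.finrank ℝ E : ℝ) with hm
  have hm0 : 0 ≤ m := by positivity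
  obtain ⟨hs1, hs2⟩ := abs_le.1 hs
  have hlog : -Real.log (1 - s / 4) ≤ s / 4 + 2 * (s / 4) ^ 2 := by
    have h4 : |s / 4| ≤ 1 / 4 := by rw [abs_div]; norm_num; linarith
    have h := Real.abs_log_sub_add_sum_range_le (x := s / 4) (by linarith) 1
    simp only [Finset.sum_range_one, zero_add, pow_one, Nat.cast_zero, div_one] at h
    have h5 : |s / 4| ^ (1 + 1) / (1 - |s / 4|) ≤ 2 * (s / 4) ^ 2 := by
      rw [div_le_iff₀ (by linarith), show (1 + 1) = 2 from rfl, sq_abs]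
      nlinarith [sq_nonneg (s / 4)]
    have := (abs_le.1 (h.trans h5)).1
    linarith
  have hM := mul_meas_ge_le_lintegral (μ := stdGaussian E)
    (f := fun x : E => ENNReal.ofReal (Real.exp (s / 8 * ‖x‖ ^ 2))) (by fun_prop)
    (ENNReal.ofReal (Real.exp (s / 8 * (m * (1 + s)))))
  rw [lintegral_exp_sq_norm_stdGaussian (by linarith)] at hM
  have hset : {x : E | s / 8 * (m * (1 + s)) ≤ s / 8 * ‖x‖ ^ 2} =
      {x : E | ENNReal.ofReal (Real.exp (s / 8 * (m * (1 + s)))) ≤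
        ENNReal.ofReal (Real.exp (s / 8 * ‖x‖ ^ 2))} := by
    ext x
    simp [ENNReal.ofReal_le_ofReal_iff (Real.exp_pos _).le]
  rw [hset]
  rw [mul_comm, ← ENNReal.le_div_iff_mul_le (by left; simp [Real.exp_pos]) (by simp),
    ← ENNReal.ofReal_div_of_pos (Real.exp_pos _)] at hM
  refine hM.trans (ENNReal.ofReal_le_ofReal ?_)
  rw [Real.rpow_def_of_pos (by linarith), ← Real.exp_sub, Real.exp_le_exp,
    show 1 - 2 * (s / 8) = 1 - s / 4 by ring]
  have := mul_le_mul_of_nonneg_left hlog hm0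
  nlinarith

theorem stdGaussian_abs_norm_sq_tail (hd : 0 < Module.finrank ℝ E) {τ : ℝ} (h0 : 0 < τ)
    (h1 : τ ≤ 1) :
    stdGaussian E {x | τ < |‖x‖ ^ 2 / Module.finrank ℝ E - 1|} ≤
      ENNReal.ofReal (2 * Real.exp (-(Module.finrank ℝ E * τ ^ 2 / 16))) := by
  have hm : (0 : ℝ) < Module.finrank ℝ E := by exact_mod_cast hd
  have h2 := stdGaussian_norm_sq_tail (E := E) (s := τ) (by rw [abs_of_pos h0]; exact h1)
  have h3 := stdGaussian_norm_sq_tail (E := E) (s := -τ) (by rw [abs_neg, abs_of_pos h0]; exact h1)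
  rw [neg_sq] at h3
  calc _ ≤ stdGaussian E ({x | τ / 8 * (Module.finrank ℝ E * (1 + τ)) ≤ τ / 8 * ‖x‖ ^ 2} ∪
        {x | -τ / 8 * (Module.finrank ℝ E * (1 + -τ)) ≤ -τ / 8 * ‖x‖ ^ 2}) := by
        refine measure_mono fun x hx => ?_
        rcases lt_abs.1 (Set.mem_ofPred_eq ▸ hx) with h | h
        · left
          have : 1 + τ ≤ ‖x‖ ^ 2 / Module.finrank ℝ E := by linarith
          rw [le_div_iff₀ hm] at this
          simp only [Set.mem_ofPred_eq]
          gcongr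
          linarith
        · right
          have : ‖x‖ ^ 2 / Module.finrank ℝ E ≤ 1 - τ := by linarith
          rw [div_le_iff₀ hm] at this
          simp only [Set.mem_ofPred_eq]
          nlinarith
    _ ≤ _ := measure_union_le _ _
    _ ≤ _ := add_le_add h2 h3
    _ = _ := by rw [← ENNReal.ofReal_add (by positivity) (by positivity)]; ring_nf

/-- The direction of a standard Gaussian vector is uniform on the sphere. -/
theorem uniformSphere_le_stdGaussian {d : ℕ} (hd : 0 < d) {S : Set (UnitSphere d)}
    (hS : MeasurableSet S) {T : Set (EuclideanSpace ℝ (Fin d))} (hT : MeasurableSet T)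
    (h : ∀ x : EuclideanSpace ℝ (Fin d), ∀ θ ∈ S, x = ‖x‖ • θ.1 → x ∈ T) :
    uniformSphere d S ≤ stdGaussian (EuclideanSpace ℝ (Fin d)) T := by
  have : Nonempty (Fin d) := ⟨⟨0, hd⟩⟩
  set ρ : ℝ → ℝ≥0∞ := fun r => ENNReal.ofReal
    ((2 * Real.pi) ^ (-(Module.finrank ℝ (EuclideanSpace ℝ (Fin d)) : ℝ) / 2) * Real.exp (-(1 / 2) * r ^ 2)) with hρ
  have hρm : Measurable ρ := by fun_prop
  set C := ∫⁻ r : Set.Ioi (0 : ℝ), ρ r.1 ∂(Measure.volumeIoiPow (Module.finrank ℝ (EuclideanSpace ℝ (Fin d)) - 1)) with hC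
  -- polar coordinates
  have key : ∀ g : (EuclideanSpace ℝ (Fin d)) → ℝ≥0∞, Measurable g → ∫⁻ x, g x ∂(volume : Measure (EuclideanSpace ℝ (Fin d))) =
      ∫⁻ p, g (p.2.1 • p.1.1) ∂((volume : Measure (EuclideanSpace ℝ (Fin d))).toSphere.prod
        (Measure.volumeIoiPow (Module.finrank ℝ (EuclideanSpace ℝ (Fin d)) - 1))) := by
    intro g hg
    have hmp := (volume : Measure (EuclideanSpace ℝ (Fin d))).measurePreserving_homeomorphUnitSphereProd
    rw [← hmp.lintegral_comp (f := fun p => g (p.2.1 • p.1.1)) (by fun_prop)]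
    have e : ∀ x : ({0}ᶜ : Set (EuclideanSpace ℝ (Fin d))), (homeomorphUnitSphereProd (EuclideanSpace ℝ (Fin d)) x).2.1 •
        (homeomorphUnitSphereProd (EuclideanSpace ℝ (Fin d)) x).1.1 = x.1 := by
      intro x
      rw [← homeomorphUnitSphereProd_symm_apply_coe, Homeomorph.symm_apply_apply]
    simp_rw [e]
    rw [lintegral_subtype_comap (measurableSet_singleton _).compl, restrict_compl_singleton]
  have hnorm : ∀ p : UnitSphere d × Set.Ioi (0 : ℝ), ‖p.2.1 • p.1.1‖ = p.2.1 := by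
    intro p
    rw [norm_smul, norm_eq_of_mem_sphere, mul_one, Real.norm_of_nonneg (le_of_lt p.2.2)]
  have hg : ∀ T' : Set (EuclideanSpace ℝ (Fin d)), MeasurableSet T' → stdGaussian (EuclideanSpace ℝ (Fin d)) T' =
      ∫⁻ p, T'.indicator 1 (p.2.1 • p.1.1) * ρ p.2.1 ∂((volume : Measure (EuclideanSpace ℝ (Fin d))).toSphere.prod
        (Measure.volumeIoiPow (Module.finrank ℝ (EuclideanSpace ℝ (Fin d)) - 1))) := by
    intro T' hT'
    rw [stdGaussian_eq_withDensity, withDensity_apply _ hT', ← lintegral_indicator hT', key _ (by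
      exact Measurable.indicator (by fun_prop) hT')]
    refine lintegral_congr fun p => ?_
    by_cases hp : p.2.1 • p.1.1 ∈ T'
    · simp only [Set.indicator_of_mem hp, hnorm, hρ, Pi.one_apply, one_mul]
    · simp only [Set.indicator_of_notMem hp, zero_mul]
  -- The total mass 1 of the Gaussian identifies the radial integral `C` as the normalising constant
  -- of the surface measure.
  have hone : (volume : Measure (EuclideanSpace ℝ (Fin d))).toSphere Set.univ * C = 1 := by
    have h1 := hg Set.univ MeasurableSet.univ
    simp only [measure_univ, Set.indicator_univ, Pi.one_apply, one_mul] at h1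
    rw [h1, lintegral_prod _ (by fun_prop)]
    simp only [lintegral_const]
    rw [mul_comm]
  have hSle : (volume : Measure (EuclideanSpace ℝ (Fin d))).toSphere S * C ≤ stdGaussian (EuclideanSpace ℝ (Fin d)) T := by
    rw [hg T hT]
    calc (volume : Measure (EuclideanSpace ℝ (Fin d))).toSphere S * C
        = ∫⁻ p, S.indicator 1 p.1 * ρ p.2.1 ∂((volume : Measure (EuclideanSpace ℝ (Fin d))).toSphere.prod
        (Measure.volumeIoiPow (Module.finrank ℝ (EuclideanSpace ℝ (Fin d)) - 1))) := by
          rw [lintegral_prod_mul (f := S.indicator (1 : UnitSphere d → ℝ≥0∞))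
            (g := fun r : Set.Ioi (0 : ℝ) => ρ r.1)
            ((measurable_const.indicator hS).aemeasurable) (by fun_prop), lintegral_indicator_one hS]
      _ ≤ _ := by
          refine lintegral_mono fun p => ?_
          by_cases hp : p.1 ∈ S
          · have : p.2.1 • p.1.1 ∈ T := h _ p.1 hp (by rw [hnorm])
            simp [this, hp]
          · simp [hp]
  have hne : (volume : Measure (EuclideanSpace ℝ (Fin d))).toSphere Set.univ ≠ ∞ := measure_ne_top _ _
  have hne0 : (volume : Measure (EuclideanSpace ℝ (Fin d))).toSphere Set.univ ≠ 0 := by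
    intro h0
    rw [h0, zero_mul] at hone
    exact zero_ne_one hone
  have hCe : C = ((volume : Measure (EuclideanSpace ℝ (Fin d))).toSphere Set.univ)⁻¹ :=
    ENNReal.eq_inv_of_mul_eq_one_left (by rw [mul_comm]; exact hone)
  rw [uniformSphere, Measure.smul_apply, smul_eq_mul, mul_comm, ← hCe]
  exact hSle

end GaussianVector

/-! ### Gaussian concentration for C¹ functions with bounded gradient. -/

section MaureyPisier

variable {E : Type*} [NormedAddCommGroup E] [InnerProductSpace ℝ E] [FiniteDimensional ℝ E]
  [MeasurableSpace E] [BorelSpace E]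

/-- The Maurey–Pisier exponential moment bound for a function with bounded gradient. -/
theorem lintegral_exp_sub_stdGaussian_le {Φ : E → ℝ} {v : E → E} {L : ℝ} (hv : Continuous v)
    (hΦ : ∀ x, HasFDerivAt Φ (innerSL ℝ (v x)) x) (hL : ∀ x, ‖v x‖ ≤ L) :
    ∫⁻ p, ENNReal.ofReal (Real.exp (Φ p.2 - Φ p.1)) ∂((stdGaussian E).prod (stdGaussian E)) ≤
      ENNReal.ofReal (Real.exp (Real.pi ^ 2 * L ^ 2 / 8)) := by
  -- A quarter turn carries `p.1` to `p.2` as `s` runs over [0, 1]. The velocity of the first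
  -- component is π/2 times the second, so `F ∘ rot s` is the derivative of `Φ` along the path.
  obtain ⟨rot, hrot⟩ : ∃ rot : ℝ → E × E → E × E, ∀ s p, rot s p =
    (Real.cos (Real.pi / 2 * s) • p.1 + Real.sin (Real.pi / 2 * s) • p.2,
      -Real.sin (Real.pi / 2 * s) • p.1 + Real.cos (Real.pi / 2 * s) • p.2) := ⟨_, fun _ _ => rfl⟩
  have hrotc : Continuous fun q : ℝ × (E × E) => rot q.1 q.2 := by
    simp only [hrot]
    fun_prop
  obtain ⟨F, hF⟩ : ∃ F : E × E → ℝ, ∀ p, F p = Real.pi / 2 * inner ℝ (v p.1) p.2 :=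
    ⟨_, fun _ => rfl⟩
  have hFc : Continuous F := by
    simp only [funext hF]
    exact continuous_const.mul ((hv.comp continuous_fst).inner continuous_snd)
  have hFr : ∀ p, Continuous fun s => F (rot s p) := fun p =>
    hFc.comp (hrotc.comp (by fun_prop : Continuous fun s : ℝ => (s, p)))
  have hFTC : ∀ p : E × E, Φ p.2 - Φ p.1 = ∫ s in (0 : ℝ)..1, F (rot s p) := by
    intro p
    have hd : ∀ s ∈ Set.uIcc (0 : ℝ) 1, HasDerivAt (fun s => Φ (rot s p).1) (F (rot s p)) s := by
      intro s _
      have hl : HasDerivAt (fun s : ℝ => Real.pi / 2 * s) (Real.pi / 2) s := by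
        simpa using (hasDerivAt_id s).const_mul (Real.pi / 2)
      have h1 : HasDerivAt (fun s => (rot s p).1) ((Real.pi / 2) • (rot s p).2) s := by
        have := (hl.cos.smul_const p.1).add (hl.sin.smul_const p.2)
        simp only [hrot]
        convert! this using 1
        simp only [smul_add, smul_smul, mul_comm]
      have := (hΦ (rot s p).1).comp_hasDerivAt s h1
      rw [hF, ← inner_smul_right]
      exact this
    rw [intervalIntegral.integral_eq_sub_of_hasDerivAt hd ((hFr p).intervalIntegrable _ _)]
    simp [hrot]
  have hprob : IsProbabilityMeasure (volume.restrict (Set.Ioc (0 : ℝ) 1)) := ⟨by simp⟩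
  -- Jensen's inequality for the uniform law of `s` on [0, 1].
  have hJ : ∀ p : E × E, ENNReal.ofReal (Real.exp (Φ p.2 - Φ p.1)) ≤
      ∫⁻ s in Set.Ioc (0 : ℝ) 1, ENNReal.ofReal (Real.exp (F (rot s p))) := by
    intro p
    have hi1 : IntegrableOn (fun s => F (rot s p)) (Set.Ioc (0 : ℝ) 1) :=
      (hFr p).integrableOn_Ioc
    have hi2 : IntegrableOn (fun s => Real.exp (F (rot s p))) (Set.Ioc (0 : ℝ) 1) :=
      (Real.continuous_exp.comp (hFr p)).integrableOn_Ioc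
    rw [hFTC, intervalIntegral.integral_of_le zero_le_one, ← ofReal_integral_eq_lintegral_ofReal hi2
      (by filter_upwards with s using (Real.exp_pos _).le)]
    exact ENNReal.ofReal_le_ofReal (convexOn_exp.map_integral_le Real.continuous_exp.continuousOn
      isClosed_univ (by simp) hi1 hi2)
  have hmeas : Measurable fun q : (E × E) × ℝ => ENNReal.ofReal (Real.exp (F (rot q.2 q.1))) := by
    have : Continuous fun q : (E × E) × ℝ => F (rot q.2 q.1) :=
      hFc.comp (hrotc.comp (by fun_prop : Continuous fun q : (E × E) × ℝ => (q.2, q.1)))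
    exact (Real.continuous_exp.comp this).measurable.ennreal_ofReal
  refine (lintegral_mono hJ).trans ?_
  rw [lintegral_lintegral_swap hmeas.aemeasurable]
  -- Rotation invariance of the product Gaussian removes `rot s`; for fixed `x`, `F (x, ·)` is then
  -- linear in an independent Gaussian.
  have hs : ∀ s : ℝ, ∫⁻ p, ENNReal.ofReal (Real.exp (F (rot s p)))
      ∂((stdGaussian E).prod (stdGaussian E)) ≤
      ENNReal.ofReal (Real.exp (Real.pi ^ 2 * L ^ 2 / 8)) := by
    intro s
    have hm : Measurable fun p => ENNReal.ofReal (Real.exp (F p)) := by fun_prop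
    have hr : rot s = ContinuousLinearMap.rotation (Real.pi / 2 * s) := funext (hrot s)
    have h := lintegral_map (μ := (stdGaussian E).prod (stdGaussian E)) hm
      (ContinuousLinearMap.rotation (Real.pi / 2 * s)).continuous.measurable
    rw [hr]
    refine h.symm.trans_le ?_
    rw [IsGaussian.map_rotation_eq_self_of_forall_strongDual_eq_zero
      integral_strongDual_stdGaussian, lintegral_prod _ hm.aemeasurable]
    calc _ ≤ ∫⁻ _ : E, ENNReal.ofReal (Real.exp (Real.pi ^ 2 * L ^ 2 / 8)) ∂(stdGaussian E) := by
          refine lintegral_mono fun x => ?_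
          have e : ∀ y, F (x, y) = inner ℝ y ((Real.pi / 2) • v x) := by
            intro y
            rw [hF, inner_smul_right, real_inner_comm]
          simp_rw [e]
          rw [lintegral_exp_inner_stdGaussian]
          refine ENNReal.ofReal_le_ofReal (Real.exp_le_exp.2 ?_)
          rw [norm_smul, mul_pow, Real.norm_eq_abs, sq_abs]
          have := pow_le_pow_left₀ (norm_nonneg _) (hL x) 2
          nlinarith [sq_nonneg Real.pi, mul_le_mul_of_nonneg_left this (sq_nonneg Real.pi)]
      _ = _ := by simp
  calc _ ≤ ∫⁻ _ in Set.Ioc (0 : ℝ) 1, ENNReal.ofReal (Real.exp (Real.pi ^ 2 * L ^ 2 / 8)) :=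
        lintegral_mono fun s => hs s
    _ = _ := by simp

/-- Jensen in an independent copy replaces the expectation of Φ by Φ at that copy, so the two-point
exponential moment applies, followed by Markov's inequality. The bound `M` serves integrability only
and does not enter the estimate. -/
theorem stdGaussian_upper_tail {Φ : E → ℝ} {v : E → E} {L M η : ℝ} (hv : Continuous v)
    (hΦ : ∀ x, HasFDerivAt Φ (innerSL ℝ (v x)) x) (hL : ∀ x, ‖v x‖ ≤ L) (hL0 : 0 < L)
    (hη : 0 ≤ η) (hM : ∀ x, |Φ x| ≤ M) :
    stdGaussian E {x | η < Φ x - ∫ y, Φ y ∂(stdGaussian E)} ≤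
      ENNReal.ofReal (Real.exp (-(2 * η ^ 2 / (Real.pi ^ 2 * L ^ 2)))) := by
  have hΦc : Continuous Φ := continuous_iff_continuousAt.2 fun x => (hΦ x).continuousAt
  -- The minimiser of π²l²L²/8 - lη.
  set l : ℝ := 4 * η / (Real.pi ^ 2 * L ^ 2) with hl
  have hl0 : 0 ≤ l := by positivity
  have hmp := lintegral_exp_sub_stdGaussian_le (Φ := fun x => -l * Φ x) (v := fun x => (-l) • v x)
    (L := l * L) (by fun_prop) (fun x => by
      have := (hΦ x).const_mul (-l)
      convert! this using 1
      ext y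
      simp) (fun x => by
      rw [norm_smul, norm_neg, Real.norm_of_nonneg hl0]
      exact mul_le_mul_of_nonneg_left (hL x) hl0)
  rw [lintegral_prod _ (by fun_prop)] at hmp
  have hint : ∀ a b : ℝ, Integrable (fun y => Real.exp (a + b * Φ y)) (stdGaussian E) := by
    intro a b
    refine Integrable.of_bound (by fun_prop) (Real.exp (|a| + |b| * M)) ?_
    filter_upwards with y
    rw [Real.norm_of_nonneg (Real.exp_pos _).le, Real.exp_le_exp]
    have : b * Φ y ≤ |b| * M := (le_abs_self _).trans (by
      rw [abs_mul]; exact mul_le_mul_of_nonneg_left (hM y) (abs_nonneg _))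
    linarith [le_abs_self a]
  have hΦi : Integrable Φ (stdGaussian E) :=
    Integrable.of_bound (by fun_prop) M (by filter_upwards with y using hM y)
  have hJ : ∀ x, ENNReal.ofReal (Real.exp (l * (Φ x - ∫ y, Φ y ∂(stdGaussian E)))) ≤
      ∫⁻ y, ENNReal.ofReal (Real.exp (-l * Φ y - -l * Φ x)) ∂(stdGaussian E) := by
    intro x
    have e : ∀ y, -l * Φ y - -l * Φ x = l * Φ x + -l * Φ y := fun y => by ring
    simp_rw [e]
    rw [← ofReal_integral_eq_lintegral_ofReal (hint _ _)
      (by filter_upwards with s using (Real.exp_pos _).le)]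
    refine ENNReal.ofReal_le_ofReal ?_
    have := convexOn_exp.map_integral_le (μ := stdGaussian E) (f := fun y => l * Φ x + -l * Φ y)
      Real.continuous_exp.continuousOn isClosed_univ (by simp) (by fun_prop) (hint _ _)
    refine le_trans (le_of_eq ?_) this
    have e2 : ∫ y, -l * Φ y ∂(stdGaussian E) = -l * ∫ y, Φ y ∂(stdGaussian E) :=
      integral_const_mul _ _
    rw [integral_add (by fun_prop) (by fun_prop), e2, integral_const, probReal_univ, one_smul]
    ring_nf
  have h1 := (lintegral_mono hJ).trans hmp
  have hMk := mul_meas_ge_le_lintegral (μ := stdGaussian E) (f := fun x => ENNReal.ofReal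
    (Real.exp (l * (Φ x - ∫ y, Φ y ∂(stdGaussian E))))) (by fun_prop)
    (ENNReal.ofReal (Real.exp (l * η)))
  have h2 := hMk.trans h1
  rw [mul_comm, ← ENNReal.le_div_iff_mul_le (by left; simp [Real.exp_pos]) (by simp),
    ← ENNReal.ofReal_div_of_pos (Real.exp_pos _)] at h2
  refine (measure_mono fun x hx => ?_).trans (h2.trans (ENNReal.ofReal_le_ofReal ?_))
  · exact ENNReal.ofReal_le_ofReal (Real.exp_le_exp.2 (mul_le_mul_of_nonneg_left
      (le_of_lt hx) hl0))
  · rw [← Real.exp_sub, Real.exp_le_exp, hl]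
    apply le_of_eq
    have := Real.pi_ne_zero
    field_simp
    ring

theorem stdGaussian_abs_tail {Φ : E → ℝ} {v : E → E} {L M η : ℝ} (hv : Continuous v)
    (hΦ : ∀ x, HasFDerivAt Φ (innerSL ℝ (v x)) x) (hL : ∀ x, ‖v x‖ ≤ L) (hL0 : 0 < L)
    (hη : 0 ≤ η) (hM : ∀ x, |Φ x| ≤ M) :
    stdGaussian E {x | η < |Φ x - ∫ y, Φ y ∂(stdGaussian E)|} ≤
      ENNReal.ofReal (2 * Real.exp (-(2 * η ^ 2 / (Real.pi ^ 2 * L ^ 2)))) := by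
  have h1 := stdGaussian_upper_tail (η := η) hv hΦ hL hL0 hη hM
  have h2 := stdGaussian_upper_tail (η := η) (Φ := fun x => -Φ x) (v := fun x => -v x) hv.neg
    (fun x => by
      convert! (hΦ x).neg using 1
      ext y
      simp) (by simpa using hL) hL0 hη (by simpa using hM)
  calc _ ≤ stdGaussian E ({x | η < Φ x - ∫ y, Φ y ∂(stdGaussian E)} ∪
        {x | η < -Φ x - ∫ y, -Φ y ∂(stdGaussian E)}) := by
        refine measure_mono fun x hx => ?_
        rcases lt_abs.1 (Set.mem_ofPred_eq ▸ hx) with h | h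
        · exact Or.inl h
        · right
          simp only [Set.mem_ofPred_eq, integral_neg]
          linarith
    _ ≤ _ := measure_union_le _ _
    _ ≤ _ := add_le_add h1 h2
    _ = _ := by rw [← ENNReal.ofReal_add (by positivity) (by positivity)]; ring_nf

end MaureyPisier

/-! ### Smooth steps and the interpolation of Lipschitz functions by them. -/

section SmoothStep

/-- Squared positive parts are the building blocks of the steps: concentration asks for test
functions with a continuous derivative, which piecewise linear interpolation would not supply. -/
theorem hasDerivAt_max_zero_sq (s : ℝ) : HasDerivAt (fun s : ℝ => max s 0 ^ 2) (2 * max s 0) s := by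
  rcases lt_trichotomy s 0 with h | rfl | h
  · rw [max_eq_right h.le, mul_zero]
    refine (hasDerivAt_const s (0 : ℝ)).congr_of_eventuallyEq ?_
    filter_upwards [Iio_mem_nhds h] with x hx
    rw [max_eq_right (le_of_lt hx)]
    norm_num
  · have h1 : HasDerivWithinAt (fun s : ℝ => max s 0 ^ 2) 0 (Set.Iic 0) 0 := by
      refine (hasDerivWithinAt_const (0 : ℝ) _ (0 : ℝ)).congr ?_ (by simp)
      intro x hx
      rw [max_eq_right hx]
      norm_num
    have h2 : HasDerivWithinAt (fun s : ℝ => max s 0 ^ 2) 0 (Set.Ici 0) 0 := by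
      have := (hasDerivAt_pow 2 (0 : ℝ)).hasDerivWithinAt (s := Set.Ici 0)
      simp only [Nat.cast_ofNat, Nat.add_one_sub_one, pow_one, mul_zero] at this
      refine this.congr ?_ (by simp)
      intro x hx
      rw [max_eq_left hx]
    have := h1.union h2
    rw [Set.Iic_union_Ici, hasDerivWithinAt_univ] at this
    simpa using this
  · rw [max_eq_left h.le]
    have := hasDerivAt_pow 2 s
    simp only [Nat.cast_ofNat, Nat.add_one_sub_one, pow_one] at this
    refine this.congr_of_eventuallyEq ?_
    filter_upwards [Ioi_mem_nhds h] with x hx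
    rw [max_eq_left (le_of_lt hx)]

/-- A `C¹` function increasing from `0` on `(-∞, 0]` to `1` on `[1, ∞)`. -/
noncomputable def smoothStep (s : ℝ) : ℝ :=
  2 * max s 0 ^ 2 - 4 * max (s - 1 / 2) 0 ^ 2 + 2 * max (s - 1) 0 ^ 2

/-- The derivative of `smoothStep`. -/
noncomputable def smoothStepDeriv (s : ℝ) : ℝ :=
  4 * max s 0 - 8 * max (s - 1 / 2) 0 + 4 * max (s - 1) 0

theorem hasDerivAt_smoothStep (s : ℝ) : HasDerivAt smoothStep (smoothStepDeriv s) s := by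
  have h1 := (hasDerivAt_max_zero_sq s).const_mul 2
  have h2 := ((hasDerivAt_max_zero_sq (s - 1 / 2)).comp_sub_const s (1 / 2)).const_mul 4
  have h3 := ((hasDerivAt_max_zero_sq (s - 1)).comp_sub_const s 1).const_mul 2
  convert! (h1.sub h2).add h3 using 1
  simp only [smoothStepDeriv]
  ring

theorem continuous_smoothStepDeriv : Continuous smoothStepDeriv := by
  unfold smoothStepDeriv
  fun_prop

theorem continuous_smoothStep : Continuous smoothStep := by
  unfold smoothStep
  fun_prop

theorem smoothStep_of_nonpos {s : ℝ} (h : s ≤ 0) : smoothStep s = 0 := by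
  rw [smoothStep, max_eq_right h, max_eq_right (by linarith), max_eq_right (by linarith)]
  norm_num

theorem smoothStep_of_one_le {s : ℝ} (h : 1 ≤ s) : smoothStep s = 1 := by
  rw [smoothStep, max_eq_left (by linarith), max_eq_left (by linarith), max_eq_left (by linarith)]
  ring

theorem smoothStep_mem_Icc (s : ℝ) : smoothStep s ∈ Set.Icc (0 : ℝ) 1 := by
  rcases le_total s 0 with h | h
  · simp [smoothStep_of_nonpos h]
  rcases le_total 1 s with h' | h'
  · simp [smoothStep_of_one_le h']
  rw [smoothStep, max_eq_left h, max_eq_right (by linarith : s - 1 ≤ 0)]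
  rcases le_total s (1 / 2) with h2 | h2
  · rw [max_eq_right (by linarith)]
    constructor <;> nlinarith
  · rw [max_eq_left (by linarith)]
    constructor <;> nlinarith [sq_nonneg (1 - s)]

theorem abs_smoothStep_le_one (s : ℝ) : |smoothStep s| ≤ 1 := by
  obtain ⟨h0, h1⟩ := smoothStep_mem_Icc s
  rwa [abs_of_nonneg h0]

theorem abs_smoothStepDeriv_le (s : ℝ) : |smoothStepDeriv s| ≤ 2 := by
  rw [abs_le, smoothStepDeriv]
  rcases max_cases s 0 with ⟨h1, _⟩ | ⟨h1, _⟩ <;>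
  rcases max_cases (s - 1 / 2) 0 with ⟨h2, _⟩ | ⟨h2, _⟩ <;>
  rcases max_cases (s - 1) 0 with ⟨h3, _⟩ | ⟨h3, _⟩ <;>
  rw [h1, h2, h3] <;> constructor <;> linarith

/-- The `k`-th node of the equidistant partition of `[-R, R]` into `N` intervals. -/
noncomputable def gridPoint (R : ℝ) (N k : ℕ) : ℝ := -R + k * (2 * R / N)

/-- The smooth step along the `k`-th interval of the equidistant partition of `[-R, R]`. -/
noncomputable def gridStep (R : ℝ) (N k : ℕ) (t : ℝ) : ℝ := smoothStep ((t - gridPoint R N k) / (2 * R / N))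

theorem abs_gridStep_le_one (R : ℝ) (N k : ℕ) (t : ℝ) : |gridStep R N k t| ≤ 1 :=
  abs_smoothStep_le_one _

theorem continuous_gridStep (R : ℝ) (N k : ℕ) : Continuous (gridStep R N k) := by
  unfold gridStep
  exact continuous_smoothStep.comp (by fun_prop)

/-- Interpolation of `f` along the equidistant partition of `[-R, R]` by smooth steps. -/
noncomputable def stepInterp (f : ℝ → ℝ) (R : ℝ) (N : ℕ) (t : ℝ) : ℝ :=
  f (gridPoint R N 0) +
    ∑ k ∈ Finset.range N, (f (gridPoint R N (k + 1)) - f (gridPoint R N k)) * gridStep R N k t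

theorem continuous_stepInterp (f : ℝ → ℝ) (R : ℝ) (N : ℕ) : Continuous (stepInterp f R N) := by
  unfold stepInterp
  exact continuous_const.add (continuous_finsetSum _ fun k _ =>
    continuous_const.mul (continuous_gridStep R N k))

theorem gridPoint_succ (R : ℝ) (N k : ℕ) :
    gridPoint R N (k + 1) = gridPoint R N k + 2 * R / N := by
  simp only [gridPoint]
  push_cast
  ring

/-- Inside [-R, R] the interpolant is a convex combination of the values at the two neighbouring
nodes, so the error is at most the mesh 2R/N. Outside, the trivial error 2 is at most 2t²/R², a term
that second moments control. -/
theorem abs_sub_stepInterp_le {f : ℝ → ℝ} (hf : ∀ x, |f x| ≤ 1)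
    (hl : ∀ x y, |f x - f y| ≤ |x - y|) {R : ℝ} (hR : 0 < R) {N : ℕ} (hN : 0 < N) (t : ℝ) :
    |f t - stepInterp f R N t| ≤ 2 * R / N + 2 * t ^ 2 / R ^ 2 := by
  have hN' : (0 : ℝ) < N := by exact_mod_cast hN
  obtain ⟨δ, hδ⟩ : ∃ δ : ℝ, δ = 2 * R / N := ⟨_, rfl⟩
  have hδ0 : 0 < δ := by rw [hδ]; positivity
  have hNδ : N * δ = 2 * R := by rw [hδ]; field_simp
  have hstep : ∀ k, gridStep R N k t = smoothStep ((t - gridPoint R N k) / δ) := fun k => by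
    rw [gridStep, hδ]
  have hg : ∀ k : ℕ, gridPoint R N k = -R + k * δ := fun k => by rw [gridPoint, hδ]
  have hsucc : ∀ k : ℕ, gridPoint R N (k + 1) = gridPoint R N k + δ := fun k => by
    rw [gridPoint_succ, hδ]
  rw [← hδ]
  have hzero : ∀ k, t ≤ gridPoint R N k → gridStep R N k t = 0 := fun k hk => by
    rw [hstep]
    exact smoothStep_of_nonpos (div_nonpos_of_nonpos_of_nonneg (by linarith) hδ0.le)
  have hone : ∀ k, gridPoint R N (k + 1) ≤ t → gridStep R N k t = 1 := fun k hk => by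
    rw [hstep]
    rw [hsucc] at hk
    exact smoothStep_of_one_le ((one_le_div hδ0).2 (by linarith))
  have htel : ∀ j : ℕ, ∑ k ∈ Finset.range j, (f (gridPoint R N (k + 1)) - f (gridPoint R N k)) =
      f (gridPoint R N j) - f (gridPoint R N 0) := fun j =>
    Finset.sum_range_sub (fun k => f (gridPoint R N k)) j
  have hfar : ∀ x, R ^ 2 ≤ t ^ 2 → |f t - f x| ≤ δ + 2 * t ^ 2 / R ^ 2 := by
    intro x ht
    have h1 : 2 ≤ 2 * t ^ 2 / R ^ 2 := by
      rw [le_div_iff₀ (by positivity)]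
      linarith
    have := abs_sub (f t) (f x)
    linarith [hf t, hf x]
  rcases lt_or_ge t (-R) with h1 | h1
  · have hs : stepInterp f R N t = f (gridPoint R N 0) := by
      rw [stepInterp, Finset.sum_eq_zero, add_zero]
      intro k _
      rw [hzero k, mul_zero]
      rw [hg]
      have : 0 ≤ k * δ := by positivity
      linarith
    rw [hs]
    exact hfar _ (by nlinarith)
  rcases le_or_gt R t with h2 | h2
  · have hs : stepInterp f R N t = f (gridPoint R N N) := by
      rw [stepInterp, Finset.sum_congr rfl (g := fun k =>
        f (gridPoint R N (k + 1)) - f (gridPoint R N k)), htel]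
      · ring
      intro k hk
      rw [hone k, mul_one]
      rw [hg]
      have hk' : ((k + 1 : ℕ) : ℝ) ≤ N := by exact_mod_cast Finset.mem_range.1 hk
      have := mul_le_mul_of_nonneg_right hk' hδ0.le
      linarith
    rw [hs]
    exact hfar _ (by nlinarith)
  · set j := ⌊(t + R) / δ⌋₊ with hj
    have h0 : 0 ≤ (t + R) / δ := div_nonneg (by linarith) hδ0.le
    have hj1 : gridPoint R N j ≤ t := by
      have := Nat.floor_le h0
      rw [← hj, le_div_iff₀ hδ0] at this
      rw [hg]
      linarith
    have hj2 : t < gridPoint R N (j + 1) := by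
      have := Nat.lt_floor_add_one ((t + R) / δ)
      rw [← hj, div_lt_iff₀ hδ0] at this
      rw [hg]
      push_cast
      linarith
    have hjN : j < N := by
      rw [hj, Nat.floor_lt h0, div_lt_iff₀ hδ0]
      linarith
    have hmono : ∀ a b : ℕ, a ≤ b → gridPoint R N a ≤ gridPoint R N b := by
      intro a b hab
      rw [hg, hg]
      have : (a : ℝ) ≤ b := by exact_mod_cast hab
      gcongr
    have hs : stepInterp f R N t = f (gridPoint R N j) +
        (f (gridPoint R N (j + 1)) - f (gridPoint R N j)) * gridStep R N j t := by
      have hsub : Finset.range (j + 1) ⊆ Finset.range N := Finset.range_subset_range.2 hjN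
      rw [stepInterp, ← Finset.sum_subset hsub, Finset.sum_range_succ, Finset.sum_congr rfl
        (g := fun k => f (gridPoint R N (k + 1)) - f (gridPoint R N k)), htel]
      · ring
      · intro k hk
        rw [hone k, mul_one]
        exact (hmono _ _ (Finset.mem_range.1 hk)).trans hj1
      · intro k _ hk
        rw [hzero k, mul_zero]
        refine hj2.le.trans (hmono _ _ ?_)
        simpa using hk
    obtain ⟨hψ0, hψ1⟩ : gridStep R N j t ∈ Set.Icc (0 : ℝ) 1 := smoothStep_mem_Icc _
    have ha : |f t - f (gridPoint R N j)| ≤ δ := (hl _ _).trans (by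
      rw [abs_of_nonneg (by linarith)]
      linarith [hsucc j])
    have hb : |f t - f (gridPoint R N (j + 1))| ≤ δ := (hl _ _).trans (by
      rw [abs_of_nonpos (by linarith)]
      linarith [hsucc j])
    rw [hs]
    have : |f t - (f (gridPoint R N j) +
        (f (gridPoint R N (j + 1)) - f (gridPoint R N j)) * gridStep R N j t)| ≤ δ := by
      rw [abs_le] at ha hb ⊢
      constructor <;> nlinarith
    have h3 : 0 ≤ 2 * t ^ 2 / R ^ 2 := by positivity
    linarith

end SmoothStep

/-! ### Gaussian laws of different variances. -/

section GaussianScale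

/-- Comparison of Gaussian laws of different variances on functions bounded by one. -/
theorem abs_integral_gaussianReal_sub_le {f : ℝ → ℝ} (hfm : Measurable f) (hf : ∀ x, |f x| ≤ 1)
    {v w : ℝ} (hw : 0 ≤ w) (hwv : w ≤ v) (hv : 0 < v) :
    |∫ t, f t ∂(gaussianReal 0 v.toNNReal) - ∫ t, f t ∂(gaussianReal 0 w.toNNReal)| ≤
      2 * (1 - √(w / v)) := by
  have hbound : ∀ u : ℝ≥0, |∫ t, f t ∂(gaussianReal 0 u)| ≤ 1 := by
    intro u
    have := norm_integral_le_of_norm_le_const (μ := gaussianReal 0 u) (f := f) (C := 1)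
      (by filter_upwards with x using hf x)
    simpa using this
  rcases hw.eq_or_lt with rfl | hw0
  · have := abs_sub (∫ t, f t ∂(gaussianReal 0 v.toNNReal)) (∫ t, f t ∂(gaussianReal 0 (Real.toNNReal 0)))
    simp only [zero_div, Real.sqrt_zero]
    linarith [hbound v.toNNReal, hbound (Real.toNNReal 0)]
  have hv' : v.toNNReal ≠ 0 := by simpa using hv
  have hw' : w.toNNReal ≠ 0 := by simpa using hw0
  obtain ⟨s, hs⟩ : ∃ s, s = √(w / v) := ⟨_, rfl⟩
  have hs0 : 0 ≤ s := by rw [hs]; positivity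
  have hs1 : s ≤ 1 := by
    rw [hs, Real.sqrt_le_one]
    exact (div_le_one hv).2 hwv
  rw [← hs, integral_gaussianReal_eq_integral_smul hv', integral_gaussianReal_eq_integral_smul hw']
  set p := gaussianPDFReal 0 v.toNNReal
  set q := gaussianPDFReal 0 w.toNNReal
  have hp : Integrable p := integrable_gaussianPDFReal _ _
  have hq : Integrable q := integrable_gaussianPDFReal _ _
  -- The wider density dominates `s` times the narrower one. As also s·q ≤ q, the common part of `p`
  -- and `q` has mass at least `s`, whence |p - q| ≤ p + q - 2sq.
  have hqp : ∀ t, s * q t ≤ p t := by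
    intro t
    simp only [p, q, gaussianPDFReal, Real.coe_toNNReal _ hv.le, Real.coe_toNNReal _ hw]
    rw [← mul_assoc]
    have e : s * (√(2 * Real.pi * w))⁻¹ = (√(2 * Real.pi * v))⁻¹ := by
      rw [hs, Real.sqrt_div hw, Real.sqrt_mul (by positivity) w, Real.sqrt_mul (by positivity) v]
      have : √w ≠ 0 := (Real.sqrt_pos.2 hw0).ne'
      field_simp
    rw [e]
    gcongr ?_ * Real.exp ?_
    rw [neg_div, neg_div, neg_le_neg_iff]
    gcongr
  have hfi : ∀ g : ℝ → ℝ, Integrable g → Integrable (fun t => g t • f t) := by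
    intro g hg
    refine hg.mul_bdd (c := 1) hfm.aestronglyMeasurable ?_
    filter_upwards with x using hf x
  have hp1 : ∫ t, p t = 1 := integral_gaussianPDFReal_eq_one _ hv'
  have hq1 : ∫ t, q t = 1 := integral_gaussianPDFReal_eq_one _ hw'
  rw [← integral_sub (hfi p hp) (hfi q hq)]
  calc |∫ t, (p t • f t - q t • f t)| ≤ ∫ t, |p t • f t - q t • f t| := abs_integral_le_integral_abs
    _ ≤ ∫ t, (p t + (1 - 2 * s) * q t) := by
        refine integral_mono ((hfi p hp).sub (hfi q hq)).abs (hp.add (hq.const_mul _)) fun t => ?_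
        simp only [smul_eq_mul, ← sub_mul, abs_mul]
        refine (mul_le_of_le_one_right (abs_nonneg _) (hf t)).trans ?_
        have hq0 : 0 ≤ q t := gaussianPDFReal_nonneg _ _ _
        have := hqp t
        rw [abs_le]
        constructor <;> nlinarith
    _ = 2 * (1 - s) := by
        rw [integral_add hp (hq.const_mul _), integral_const_mul, hp1, hq1]
        ring

/-- The right side is 2(1 - a) for a ≤ 1 and a - 1 for a ≥ 1. Written this way, its signed term
cancels when averaged over ratios of mean 1, leaving the constant 3/2 instead of 2. -/
theorem abs_integral_gaussianReal_sub_le_abs {f : ℝ → ℝ} (hfm : Measurable f)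
    (hf : ∀ x, |f x| ≤ 1) {a v : ℝ} (ha : 0 ≤ a) (hv : 0 < v) :
    |∫ t, f t ∂(gaussianReal 0 (a * v).toNNReal) - ∫ t, f t ∂(gaussianReal 0 v.toNNReal)| ≤
      3 / 2 * |a - 1| + (1 - a) / 2 := by
  rcases le_total a 1 with h | h
  · have h1 := abs_integral_gaussianReal_sub_le hfm hf (w := a * v) (v := v) (by positivity)
      (by nlinarith) hv
    rw [abs_sub_comm, abs_of_nonpos (by linarith : a - 1 ≤ 0)]
    rw [mul_div_assoc, div_self hv.ne', mul_one] at h1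
    have : a ≤ √a := Real.le_sqrt_of_sq_le (by nlinarith)
    linarith
  · have h1 := abs_integral_gaussianReal_sub_le hfm hf (w := v) (v := a * v) hv.le
      (by nlinarith) (by positivity)
    rw [abs_of_nonneg (by linarith : 0 ≤ a - 1)]
    have e : v / (a * v) = a⁻¹ := by field_simp
    rw [e, Real.sqrt_inv] at h1
    have hs1 : 1 ≤ √a := Real.one_le_sqrt.2 h
    have hs2 : √a ^ 2 = a := Real.sq_sqrt ha
    have h3 : 2 * (1 - (√a)⁻¹) ≤ a - 1 := by
      have h4 : (√a)⁻¹ * √a = 1 := inv_mul_cancel₀ (by positivity)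
      have h5 : 0 < (√a)⁻¹ := by positivity
      nlinarith [mul_nonneg (sub_nonneg.2 hs1) h5.le, sq_nonneg (√a - 1)]
    linarith

end GaussianScale

/-! ### Arithmetic means. -/

section Mean

/-- The arithmetic mean of finitely many real numbers. -/
noncomputable def mean {n : ℕ} (a : Fin n → ℝ) : ℝ := (1 / (n : ℝ)) * ∑ i, a i

variable {n : ℕ} (a b : Fin n → ℝ)

theorem mean_add : mean (fun i => a i + b i) = mean a + mean b := by
  simp only [mean, Finset.sum_add_distrib, mul_add]

theorem mean_sub : mean (fun i => a i - b i) = mean a - mean b := by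
  simp only [mean, Finset.sum_sub_distrib, mul_sub]

theorem mean_const_mul (c : ℝ) : mean (fun i => c * a i) = c * mean a := by
  simp only [mean, ← Finset.mul_sum]
  ring

theorem mean_const (hn : 0 < n) (c : ℝ) : mean (fun _ : Fin n => c) = c := by
  have : (n : ℝ) ≠ 0 := by exact_mod_cast hn.ne'
  simp only [mean, Finset.sum_const, Finset.card_univ, Fintype.card_fin, nsmul_eq_mul]
  field_simp

variable {a b} in
theorem mean_le_mean (h : ∀ i, a i ≤ b i) : mean a ≤ mean b :=
  mul_le_mul_of_nonneg_left (Finset.sum_le_sum fun i _ => h i) (by positivity)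

variable {a} in
theorem mean_nonneg (h : ∀ i, 0 ≤ a i) : 0 ≤ mean a :=
  mul_nonneg (by positivity) (Finset.sum_nonneg fun i _ => h i)

theorem abs_mean_le : |mean a| ≤ mean (fun i => |a i|) := by
  rw [mean, abs_mul, abs_of_nonneg (by positivity : (0 : ℝ) ≤ 1 / n)]
  exact mul_le_mul_of_nonneg_left (Finset.abs_sum_le_sum_abs _ _) (by positivity)

theorem mean_abs_sq_le : mean (fun i => |a i|) ^ 2 ≤ mean (fun i => a i ^ 2) := by
  rcases Nat.eq_zero_or_pos n with rfl | hn
  · simp [mean]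
  have hn' : (0 : ℝ) < n := by exact_mod_cast hn
  have h := sq_sum_le_card_mul_sum_sq (s := Finset.univ) (f := fun i => |a i|)
  simp only [sq_abs, Finset.card_univ, Fintype.card_fin] at h
  rw [mean, mean, mul_pow]
  calc (1 / (n : ℝ)) ^ 2 * (∑ i, |a i|) ^ 2 ≤ (1 / (n : ℝ)) ^ 2 * (n * ∑ i, a i ^ 2) := by gcongr
    _ = 1 / (n : ℝ) * ∑ i, a i ^ 2 := by field_simp

theorem mean_finset_sum {ι : Type*} (s : Finset ι) (F : ι → Fin n → ℝ) :
    mean (fun i => ∑ k ∈ s, F k i) = ∑ k ∈ s, mean (F k) := by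
  simp only [mean, Finset.mul_sum]
  rw [Finset.sum_comm]

theorem integral_mean {α : Type*} [MeasurableSpace α] {μ : Measure α} {F : Fin n → α → ℝ}
    (hF : ∀ i, Integrable (F i) μ) :
    ∫ x, mean (fun i => F i x) ∂μ = mean (fun i => ∫ x, F i x ∂μ) := by
  simp only [mean]
  rw [integral_const_mul, integral_finsetSum _ fun i _ => hF i]

theorem integrable_mean {α : Type*} [MeasurableSpace α] {μ : Measure α} {F : Fin n → α → ℝ}
    (hF : ∀ i, Integrable (F i) μ) : Integrable (fun x => mean (fun i => F i x)) μ :=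
  (integrable_finsetSum _ fun i _ => hF i).const_mul _

theorem mean_abs_inner_le {E : Type*} [NormedAddCommGroup E] [InnerProductSpace ℝ E]
    {y : Fin n → E} {b : ℝ} (hb : 0 ≤ b)
    (hy : ∀ u, mean (fun i => inner ℝ u (y i) ^ 2) ≤ b * ‖u‖ ^ 2) (u : E) :
    mean (fun i => |inner ℝ u (y i)|) ≤ √b * ‖u‖ := by
  refine abs_le_of_sq_le_sq' ?_ (by positivity) |>.2
  rw [mul_pow, Real.sq_sqrt hb]
  exact (mean_abs_sq_le _).trans (hy u)

end Mean

/-! ### Concentration of the empirical mean of one test function. -/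

section Concentration

variable {E : Type*} [NormedAddCommGroup E] [InnerProductSpace ℝ E] [FiniteDimensional ℝ E]
  [MeasurableSpace E] [BorelSpace E]

theorem stdGaussian_mean_tail {n : ℕ} (hn : 0 < n) {y : Fin n → E} {b K η : ℝ} (hb : 0 < b)
    (hy : ∀ u, mean (fun i => inner ℝ u (y i) ^ 2) ≤ b * ‖u‖ ^ 2) {h h' : ℝ → ℝ}
    (hh : ∀ s, HasDerivAt h (h' s) s) (hc : Continuous h') (hK0 : 0 < K) (hK : ∀ s, |h' s| ≤ K)
    (h1 : ∀ s, |h s| ≤ 1) (hη : 0 ≤ η) :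
    stdGaussian E {g | η < |mean (fun i => h (inner ℝ g (y i))) -
        ∫ z, mean (fun i => h (inner ℝ z (y i))) ∂(stdGaussian E)|} ≤
      ENNReal.ofReal (2 * Real.exp (-(2 * η ^ 2 / (Real.pi ^ 2 * (K ^ 2 * b))))) := by
  set v : E → E := fun g => (1 / (n : ℝ)) • ∑ i, h' (inner ℝ g (y i)) • y i with hv
  have hin : ∀ g u, inner ℝ (v g) u = mean (fun i => h' (inner ℝ g (y i)) * inner ℝ u (y i)) := by
    intro g u
    simp only [hv, real_inner_smul_left, sum_inner, mean]
    simp only [real_inner_comm]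
  have hvc : Continuous v := by fun_prop
  have hvL : ∀ g, ‖v g‖ ≤ K * √b := by
    intro g
    -- Testing the gradient against itself brings in the second-moment bound in the direction `v g`,
    -- so the Lipschitz constant involves √b rather than the lengths of the `y i`.
    have h2 : ‖v g‖ * ‖v g‖ ≤ K * √b * ‖v g‖ := by
      rw [← real_inner_self_eq_norm_mul_norm, hin]
      calc _ ≤ mean (fun i => K * |inner ℝ (v g) (y i)|) := by
            refine mean_le_mean fun i => (le_abs_self _).trans ?_
            rw [abs_mul]
            exact mul_le_mul_of_nonneg_right (hK _) (abs_nonneg _)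
        _ = K * mean (fun i => |inner ℝ (v g) (y i)|) := mean_const_mul _ _
        _ ≤ K * (√b * ‖v g‖) := by
            gcongr
            exact mean_abs_inner_le hb.le hy _
        _ = _ := by ring
    rcases (norm_nonneg (v g)).eq_or_lt with h0 | h0
    · rw [← h0]
      positivity
    · exact le_of_mul_le_mul_right h2 h0
  have hd : ∀ g, HasFDerivAt (fun g => mean (fun i => h (inner ℝ g (y i)))) (innerSL ℝ (v g)) g := by
    intro g
    have hi : ∀ i, HasFDerivAt (fun g => h (inner ℝ g (y i)))
        (h' (inner ℝ g (y i)) • innerSL ℝ (y i)) g := by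
      intro i
      have e : (fun g => h (inner ℝ g (y i))) = h ∘ (innerSL ℝ (y i)) := by
        ext g
        simp [real_inner_comm]
      rw [e]
      have := (hh (innerSL ℝ (y i) g)).comp_hasFDerivAt g (innerSL ℝ (y i)).hasFDerivAt
      simpa [real_inner_comm] using this
    have := (HasFDerivAt.fun_sum (u := Finset.univ) fun i _ => hi i).const_mul (1 / (n : ℝ))
    convert! this using 1
    ext u
    simp only [innerSL_apply_apply, hin, mean]
    simp [real_inner_comm]
  have hM : ∀ g, |mean (fun i => h (inner ℝ g (y i)))| ≤ 1 := by
    intro g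
    refine (abs_mean_le _).trans ?_
    rw [← mean_const hn 1]
    exact mean_le_mean fun i => h1 _
  have := stdGaussian_abs_tail (η := η) hvc hd hvL (by positivity) hη hM
  rwa [mul_pow, Real.sq_sqrt hb.le] at this

theorem integral_comp_inner_stdGaussian {h : ℝ → ℝ} (hh : Continuous h) (y : E) :
    ∫ g, h (inner ℝ g y) ∂(stdGaussian E) = ∫ t, h t ∂(gaussianReal 0 (‖y‖ ^ 2).toNNReal) := by
  rw [← stdGaussian_map_inner, integral_map (by fun_prop) hh.aestronglyMeasurable]

theorem integrable_inner_sq_stdGaussian (y : E) :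
    Integrable (fun g => inner ℝ g y ^ 2) (stdGaussian E) := by
  have h := integrable_sq_gaussianReal (‖y‖ ^ 2).toNNReal
  rw [← stdGaussian_map_inner] at h
  exact h.comp_measurable (by fun_prop)

theorem integral_inner_sq_stdGaussian (y : E) :
    ∫ g, inner ℝ g y ^ 2 ∂(stdGaussian E) = ‖y‖ ^ 2 := by
  rw [integral_comp_inner_stdGaussian (h := fun t => t ^ 2) (by fun_prop), integral_sq_gaussianReal,
    Real.coe_toNNReal _ (by positivity)]

end Concentration

/-! ### The bounded-Lipschitz distance: measurability and crude bounds. -/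

section BoundedLipschitz

theorem integrable_of_bounded_continuous {α : Type*} [TopologicalSpace α] [MeasurableSpace α]
    [OpensMeasurableSpace α] {f : α → ℝ} {C : ℝ} (hc : Continuous f) (hf : ∀ s, |f s| ≤ C)
    (ν : Measure α) [IsFiniteMeasure ν] : Integrable f ν :=
  Integrable.of_bound hc.aestronglyMeasurable C (by filter_upwards with x using hf x)

theorem bounds_of_blNorm_le_one {f : ℝ → ℝ} (hf : blNorm f ≤ 1) :
    (∀ x, |f x| ≤ 1) ∧ ∀ x y, |f x - f y| ≤ |x - y| := by
  constructor
  · intro x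
    have h : ENNReal.ofReal |f x| ≤ 1 :=
      (le_iSup (fun x => ENNReal.ofReal |f x|) x).trans (le_self_add.trans hf)
    exact ENNReal.ofReal_le_one.1 h
  · intro x y
    rcases eq_or_ne x y with rfl | hxy
    · simp
    have h : ENNReal.ofReal (|f x - f y| / |x - y|) ≤ 1 :=
      (le_iSup_of_le x (le_iSup_of_le y (le_iSup_of_le (f := fun _ : x ≠ y =>
        ENNReal.ofReal (|f x - f y| / |x - y|)) hxy le_rfl))).trans (le_add_self.trans hf)
    have h2 := ENNReal.ofReal_le_one.1 h
    rwa [div_le_one (abs_pos.2 (sub_ne_zero.2 hxy))] at h2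

theorem continuous_of_abs_sub_le {f : ℝ → ℝ} (hf : ∀ x y, |f x - f y| ≤ |x - y|) :
    Continuous f :=
  (LipschitzWith.of_dist_le_mul (K := 1) fun x y => by
    simpa [Real.dist_eq] using hf x y).continuous

theorem integral_projMeasure {n d : ℕ} (x : Fin n → EuclideanSpace ℝ (Fin d))
    (θ : EuclideanSpace ℝ (Fin d)) (f : ℝ → ℝ) :
    ∫ t, f t ∂(projMeasure x θ) = mean (fun i => f (inner ℝ θ (x i))) := by
  rw [projMeasure, integral_smul_measure, integral_finsetSum_measure
    fun i _ => integrable_dirac (by simp)]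
  simp [mean]

theorem dBL_projMeasure_le {n d : ℕ} {x : Fin n → EuclideanSpace ℝ (Fin d)}
    {θ : EuclideanSpace ℝ (Fin d)} {ν : Measure ℝ} {ε : ℝ}
    (h : ∀ f : ℝ → ℝ, (∀ s, |f s| ≤ 1) → (∀ s t, |f s - f t| ≤ |s - t|) →
      |mean (fun i => f (inner ℝ θ (x i))) - ∫ t, f t ∂ν| ≤ ε) :
    dBL (projMeasure x θ) ν ≤ ENNReal.ofReal ε := by
  refine iSup₂_le fun f hf => ENNReal.ofReal_le_ofReal ?_
  obtain ⟨h1, h2⟩ := bounds_of_blNorm_le_one hf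
  rw [integral_projMeasure]
  exact h f h1 h2

/-- A supremum of continuous functions of θ, even an uncountable one, is lower semicontinuous, so
the set is open. -/
theorem measurableSet_dBL_projMeasure_gt {n d : ℕ} (x : Fin n → EuclideanSpace ℝ (Fin d))
    (ν : Measure ℝ) (r : ℝ≥0∞) :
    MeasurableSet {θ : UnitSphere d | r < dBL (projMeasure x θ) ν} := by
  have hl : LowerSemicontinuous fun θ : UnitSphere d => dBL (projMeasure x θ) ν := by
    refine lowerSemicontinuous_biSup fun f hf => Continuous.lowerSemicontinuous ?_
    have hc := continuous_of_abs_sub_le (bounds_of_blNorm_le_one hf).2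
    simp only [integral_projMeasure, mean]
    refine ENNReal.continuous_ofReal.comp (continuous_abs.comp (Continuous.sub
      (continuous_const.mul (continuous_finsetSum _ fun i _ => hc.comp ?_)) continuous_const))
    fun_prop
  exact (hl.isOpen_preimage r).measurableSet

theorem abs_integral_le_one {ν : Measure ℝ} [IsProbabilityMeasure ν] {f : ℝ → ℝ}
    (hf : ∀ s, |f s| ≤ 1) : |∫ t, f t ∂ν| ≤ 1 := by
  have := norm_integral_le_of_norm_le_const (μ := ν) (f := f) (C := 1)
    (by filter_upwards with x using hf x)
  simpa using this

theorem dBL_projMeasure_le_two {n d : ℕ} (hn : 0 < n) (x : Fin n → EuclideanSpace ℝ (Fin d))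
    (θ : EuclideanSpace ℝ (Fin d)) (ν : Measure ℝ) [IsProbabilityMeasure ν] :
    dBL (projMeasure x θ) ν ≤ ENNReal.ofReal 2 := by
  refine dBL_projMeasure_le fun f h1 _ => ?_
  have h3 : |mean (fun i => f (inner ℝ θ (x i)))| ≤ 1 := by
    refine (abs_mean_le _).trans ?_
    rw [← mean_const hn 1]
    exact mean_le_mean fun i => h1 _
  linarith [abs_sub (mean (fun i => f (inner ℝ θ (x i)))) (∫ t, f t ∂ν),
    abs_integral_le_one (ν := ν) h1]

theorem integral_abs_gaussianReal_le (v : ℝ≥0) : ∫ t, |t| ∂(gaussianReal 0 v) ≤ √v := by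
  have h := variance_nonneg (fun t : ℝ => |t|) (gaussianReal 0 v)
  have hm : MemLp (fun t : ℝ => |t|) 2 (gaussianReal 0 v) :=
    (memLp_id_gaussianReal (μ := 0) (v := v) 2).abs
  rw [variance_eq_sub hm] at h
  simp only [Pi.pow_apply, sq_abs, integral_sq_gaussianReal] at h
  exact Real.le_sqrt_of_sq_le (by linarith)

/-- Both laws are compared with the point mass at 0. This disposes of the range ε² > 4B. -/
theorem dBL_projMeasure_gaussianReal_le {n d : ℕ} (hn : 0 < n)
    (x : Fin n → EuclideanSpace ℝ (Fin d)) (θ : UnitSphere d) (v : ℝ≥0) {B : ℝ}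
    (hB : mean (fun i => inner ℝ θ.1 (x i) ^ 2) ≤ B) :
    dBL (projMeasure x θ) (gaussianReal 0 v) ≤ ENNReal.ofReal (√B + √v) := by
  refine dBL_projMeasure_le fun f h1 h2 => ?_
  have hc := continuous_of_abs_sub_le h2
  have h3 : |mean (fun i => f (inner ℝ θ.1 (x i))) - f 0| ≤ √B := by
    rw [← mean_const hn (f 0), ← mean_sub]
    refine (abs_mean_le _).trans (Real.le_sqrt_of_sq_le ?_)
    refine (mean_abs_sq_le _).trans (le_trans (mean_le_mean fun i => ?_) hB)
    refine sq_le_sq.2 ?_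
    simpa using h2 (inner ℝ θ.1 (x i)) 0
  have h4 : |∫ t, f t ∂(gaussianReal 0 v) - f 0| ≤ √v := by
    have e : ∫ t, f t ∂(gaussianReal 0 v) - f 0 = ∫ t, (f t - f 0) ∂(gaussianReal 0 v) := by
      rw [integral_sub (integrable_of_bounded_continuous hc h1 _) (integrable_const _)]
      simp
    rw [e]
    refine abs_integral_le_integral_abs.trans (le_trans ?_ (integral_abs_gaussianReal_le v))
    refine integral_mono_of_nonneg (by filter_upwards with t using abs_nonneg _)
      ((memLp_id_gaussianReal (μ := 0) (v := v) 1).integrable le_rfl).abs ?_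
    filter_upwards with t
    simpa using h2 t 0
  rw [abs_le] at h3 h4 ⊢
  constructor <;> linarith [h3.1, h3.2, h4.1, h4.2]

end BoundedLipschitz

/-! ### From the probability of a bad direction to the expected waiting time. -/

section WaitingTime

/-- With probability at least 1/2 none of the first ⌊1/(2q)⌋ directions is bad, and then the waiting
time is at least 1/(2q). -/
theorem le_lintegral_waitingTime {n d : ℕ} (x : Fin n → EuclideanSpace ℝ (Fin d)) (σ ε : ℝ)
    {q : ℝ} (hq : 0 < q)
    (h : uniformSphere d {θ : UnitSphere d | ENNReal.ofReal ε <
      dBL (projMeasure x θ) (gaussianReal 0 (σ ^ 2).toNNReal)} ≤ ENNReal.ofReal q)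
    {Ω : Type*} [MeasurableSpace Ω] (P : Measure Ω) [IsProbabilityMeasure P]
    (θ : ℕ → Ω → UnitSphere d) (hθ : ∀ j, Measurable (θ j))
    (hlaw : ∀ j, P.map (θ j) = uniformSphere d) :
    ENNReal.ofReal (1 / (4 * q)) ≤
      ∫⁻ ω, (waitingTime x σ ε (fun j => θ j ω) : ℝ≥0∞) ∂P := by
  set S : Set (UnitSphere d) := {θ | ENNReal.ofReal ε <
      dBL (projMeasure x θ) (gaussianReal 0 (σ ^ 2).toNNReal)} with hS
  have hSm : MeasurableSet S := measurableSet_dBL_projMeasure_gt _ _ _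
  set m := ⌊1 / (2 * q)⌋₊ with hm
  set bad : Set Ω := ⋃ j ∈ Finset.range m, θ j ⁻¹' S with hbad
  have hbm : MeasurableSet bad := Finset.measurableSet_biUnion _ fun j _ => hθ j hSm
  have hPb : P bad ≤ ENNReal.ofReal (1 / 2) := by
    calc P bad ≤ ∑ j ∈ Finset.range m, P (θ j ⁻¹' S) := measure_biUnion_finset_le _ _
      _ ≤ ∑ j ∈ Finset.range m, ENNReal.ofReal q := by
          refine Finset.sum_le_sum fun j _ => ?_
          rw [← Measure.map_apply (hθ j) hSm, hlaw]
          exact h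
      _ = ENNReal.ofReal (m * q) := by
          rw [Finset.sum_const, Finset.card_range, nsmul_eq_mul, ENNReal.ofReal_mul (by positivity),
            ENNReal.ofReal_natCast]
      _ ≤ ENNReal.ofReal (1 / 2) := by
          refine ENNReal.ofReal_le_ofReal ?_
          have := Nat.floor_le (show 0 ≤ 1 / (2 * q) by positivity)
          calc (m : ℝ) * q ≤ 1 / (2 * q) * q := by gcongr
            _ = 1 / 2 := by field_simp
  have hPc : ENNReal.ofReal (1 / 2) ≤ P badᶜ := by
    rw [prob_compl_eq_one_sub hbm]
    refine le_trans ?_ (tsub_le_tsub_left hPb 1)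
    rw [← ENNReal.ofReal_one, ← ENNReal.ofReal_sub _ (by norm_num)]
    norm_num
  have hT : ∀ ω ∈ badᶜ, ENNReal.ofReal (1 / (2 * q)) ≤
      (waitingTime x σ ε (fun j => θ j ω) : ℝ≥0∞) := by
    intro ω hω
    -- Indices 0, …, m - 1 are good, so the one-based time is at least m + 1; the extra 1 makes up
    -- for the floor.
    have h1 : ((m + 1 : ℕ) : ℕ∞) ≤ waitingTime x σ ε (fun j => θ j ω) := by
      refine le_sInf ?_
      rintro t ⟨j, rfl, hj⟩
      rw [Nat.cast_le]
      by_contra hlt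
      refine hω ?_
      simp only [hbad, Set.mem_iUnion]
      exact ⟨j, Finset.mem_range.2 (by omega), hj⟩
    have h2 : (((m + 1 : ℕ) : ℕ∞) : ℝ≥0∞) ≤ (waitingTime x σ ε (fun j => θ j ω) : ℝ≥0∞) := by
      exact_mod_cast h1
    refine le_trans ?_ h2
    have h3 := (Nat.lt_floor_add_one (1 / (2 * q))).le
    rw [← hm] at h3
    calc ENNReal.ofReal (1 / (2 * q)) ≤ ENNReal.ofReal ((m + 1 : ℕ) : ℝ) := by
          refine ENNReal.ofReal_le_ofReal ?_
          push_cast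
          exact h3
      _ = _ := by rw [ENNReal.ofReal_natCast]; rfl
  calc ENNReal.ofReal (1 / (4 * q)) = ENNReal.ofReal (1 / (2 * q)) * ENNReal.ofReal (1 / 2) := by
        rw [← ENNReal.ofReal_mul (by positivity)]
        congr 1
        field_simp
        norm_num
    _ ≤ ENNReal.ofReal (1 / (2 * q)) * P badᶜ := by gcongr
    _ = ∫⁻ _ in badᶜ, ENNReal.ofReal (1 / (2 * q)) ∂P := by simp
    _ ≤ ∫⁻ ω in badᶜ, (waitingTime x σ ε (fun j => θ j ω) : ℝ≥0∞) ∂P :=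
        setLIntegral_mono' hbm.compl hT
    _ ≤ _ := setLIntegral_le_lintegral _ _

end WaitingTime

/-! ### From finitely many steps to all bounded Lipschitz functions. -/

section Deviation

variable {E : Type*} [NormedAddCommGroup E] [InnerProductSpace ℝ E] [FiniteDimensional ℝ E]
  [MeasurableSpace E] [BorelSpace E]

/-- Only the coefficients depend on `f`; the deviations of the steps do not. For 1-Lipschitz `f` the
coefficients have total size at most 2R, whatever `N` is. -/
theorem mean_sub_stepInterp_eq {n : ℕ} (hn : 0 < n) (y : Fin n → E) (f : ℝ → ℝ) (R : ℝ) (N : ℕ)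
    (g : E) :
    mean (fun i => stepInterp f R N (inner ℝ g (y i))) -
        ∫ z, mean (fun i => stepInterp f R N (inner ℝ z (y i))) ∂(stdGaussian E) =
      ∑ k ∈ Finset.range N, (f (gridPoint R N (k + 1)) - f (gridPoint R N k)) *
        (mean (fun i => gridStep R N k (inner ℝ g (y i))) -
          ∫ z, mean (fun i => gridStep R N k (inner ℝ z (y i))) ∂(stdGaussian E)) := by
  have e : ∀ z : E, mean (fun i => stepInterp f R N (inner ℝ z (y i))) = f (gridPoint R N 0) +
      ∑ k ∈ Finset.range N, (f (gridPoint R N (k + 1)) - f (gridPoint R N k)) *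
        mean (fun i => gridStep R N k (inner ℝ z (y i))) := by
    intro z
    simp only [stepInterp]
    rw [mean_add, mean_const hn, mean_finset_sum]
    simp only [mean_const_mul]
  have hi : ∀ k, Integrable (fun z => mean (fun i => gridStep R N k (inner ℝ z (y i))))
      (stdGaussian E) := fun k => integrable_mean fun i =>
    integrable_of_bounded_continuous
      ((continuous_gridStep R N k).comp (by fun_prop)) (fun z => abs_gridStep_le_one R N k _) _
  simp_rw [e]
  rw [integral_add (integrable_const _) (integrable_finsetSum _ fun k _ => (hi k).const_mul _),
    integral_finsetSum _ fun k _ => (hi k).const_mul _]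
  simp only [integral_const_mul, integral_const, probReal_univ, one_smul, mul_sub,
    Finset.sum_sub_distrib]
  ring

/-- If a Gaussian vector `g` has about its typical length and the smooth steps have about their
typical means, then all bounded Lipschitz functions have about their typical means. -/
theorem abs_mean_sub_integral_le {n : ℕ} (hn : 0 < n) {y : Fin n → E} {b s R η r : ℝ} {N : ℕ}
    (hR : 0 < R) (hN : 0 < N)
    (hy : ∀ u, mean (fun i => inner ℝ u (y i) ^ 2) ≤ b * ‖u‖ ^ 2)
    (hs : mean (fun i => ‖y i‖ ^ 2) ≤ s) {g : E} (hg : b * ‖g‖ ^ 2 ≤ r)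
    (hstep : ∀ k < N, |mean (fun i => gridStep R N k (inner ℝ g (y i))) -
        ∫ z, mean (fun i => gridStep R N k (inner ℝ z (y i))) ∂(stdGaussian E)| ≤ η)
    {f : ℝ → ℝ} (h1 : ∀ t, |f t| ≤ 1) (h2 : ∀ t u, |f t - f u| ≤ |t - u|) :
    |mean (fun i => f (inner ℝ g (y i))) -
        ∫ z, mean (fun i => f (inner ℝ z (y i))) ∂(stdGaussian E)| ≤
      2 * (2 * R / N) + 2 / R ^ 2 * (r + s) + 2 * R * η := by
  have hN' : (0 : ℝ) < N := by exact_mod_cast hN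
  have hfc := continuous_of_abs_sub_le h2
  set p := stepInterp f R N with hp
  have hpc : Continuous p := continuous_stepInterp f R N
  have hfp := abs_sub_stepInterp_le h1 h2 hR hN
  have hpt : ∀ z : E, |mean (fun i => f (inner ℝ z (y i))) - mean (fun i => p (inner ℝ z (y i)))| ≤
      2 * R / N + 2 / R ^ 2 * mean (fun i => inner ℝ z (y i) ^ 2) := by
    intro z
    rw [← mean_sub, ← mean_const_mul, ← mean_const hn (2 * R / N), ← mean_add]
    refine (abs_mean_le _).trans (mean_le_mean fun i => (hfp _).trans (le_of_eq ?_))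
    ring
  have hsqi : Integrable (fun z => mean (fun i => inner ℝ z (y i) ^ 2)) (stdGaussian E) :=
    integrable_mean fun i => integrable_inner_sq_stdGaussian _
  have hfi : Integrable (fun z => mean (fun i => f (inner ℝ z (y i)))) (stdGaussian E) :=
    integrable_mean fun i => integrable_of_bounded_continuous (hfc.comp (by fun_prop))
      (fun z => h1 _) _
  have hbi : Integrable (fun z => 2 * R / N + 2 / R ^ 2 * mean (fun i => inner ℝ z (y i) ^ 2))
      (stdGaussian E) := (integrable_const _).add (hsqi.const_mul _)
  -- Obtained from the integrability of the `f` mean and of the difference, which is dominated by a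
  -- quadratic.
  have hpi : Integrable (fun z => mean (fun i => p (inner ℝ z (y i)))) (stdGaussian E) := by
    have hd : Integrable (fun z => mean (fun i => f (inner ℝ z (y i))) -
        mean (fun i => p (inner ℝ z (y i)))) (stdGaussian E) := by
      refine Integrable.mono' hbi ?_ (by filter_upwards with z using hpt z)
      refine Continuous.aestronglyMeasurable ?_
      simp only [mean]
      fun_prop
    have := hfi.sub hd
    refine this.congr (by filter_upwards with z; simp)
  have ha := (hpt g).trans (add_le_add_right (mul_le_mul_of_nonneg_left ((hy g).trans hg)
    (by positivity)) _)
  have hb : |∫ z, mean (fun i => f (inner ℝ z (y i))) ∂(stdGaussian E) -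
      ∫ z, mean (fun i => p (inner ℝ z (y i))) ∂(stdGaussian E)| ≤ 2 * R / N + 2 / R ^ 2 * s := by
    rw [← integral_sub hfi hpi]
    refine abs_integral_le_integral_abs.trans ((integral_mono (hfi.sub hpi).abs hbi hpt).trans ?_)
    rw [integral_add (integrable_const _) (hsqi.const_mul _), integral_const_mul,
      integral_mean fun i => integrable_inner_sq_stdGaussian _]
    simp only [integral_inner_sq_stdGaussian, integral_const, probReal_univ, one_smul]
    gcongr
  have hc : |mean (fun i => p (inner ℝ g (y i))) -
      ∫ z, mean (fun i => p (inner ℝ z (y i))) ∂(stdGaussian E)| ≤ 2 * R * η := by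
    rw [hp, mean_sub_stepInterp_eq hn]
    calc _ ≤ ∑ k ∈ Finset.range N, |(f (gridPoint R N (k + 1)) - f (gridPoint R N k)) *
        (mean (fun i => gridStep R N k (inner ℝ g (y i))) -
          ∫ z, mean (fun i => gridStep R N k (inner ℝ z (y i))) ∂(stdGaussian E))| :=
          Finset.abs_sum_le_sum_abs _ _
      _ ≤ ∑ k ∈ Finset.range N, 2 * R / N * η := by
          refine Finset.sum_le_sum fun k hk => ?_
          rw [abs_mul]
          have hδ : |f (gridPoint R N (k + 1)) - f (gridPoint R N k)| ≤ 2 * R / N := by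
            refine (h2 _ _).trans (le_of_eq ?_)
            rw [gridPoint_succ, add_sub_cancel_left, abs_of_nonneg (by positivity)]
          exact mul_le_mul hδ (hstep k (Finset.mem_range.1 hk)) (abs_nonneg _) (by positivity)
      _ = 2 * R * η := by
          rw [Finset.sum_const, Finset.card_range, nsmul_eq_mul]
          field_simp
  rw [abs_le] at *
  have e : 2 / R ^ 2 * (r + s) = 2 / R ^ 2 * r + 2 / R ^ 2 * s := by ring
  rw [e]
  constructor <;> linarith [ha.1, ha.2, hb.1, hb.2, hc.1, hc.2]

/-- The ratios ‖y_i‖²/σ² have mean 1, which cancels the signed part of the variance comparison. The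
constant 3/2 matters: as 2A/d may equal ε, a constant 2 would leave no room for the other errors. -/
theorem abs_integral_mean_sub_gaussianReal_le {n : ℕ} (hn : 0 < n) (y : Fin n → E) {σ a : ℝ}
    (hσ : 0 < σ) (hy : mean (fun i => ‖y i‖ ^ 2) = σ ^ 2)
    (ha : mean (fun i => |‖y i‖ ^ 2 / σ ^ 2 - 1|) ≤ a)
    {f : ℝ → ℝ} (hf : Continuous f) (h1 : ∀ t, |f t| ≤ 1) :
    |∫ z, mean (fun i => f (inner ℝ z (y i))) ∂(stdGaussian E) -
      ∫ t, f t ∂(gaussianReal 0 (σ ^ 2).toNNReal)| ≤ 3 / 2 * a := by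
  rw [integral_mean (F := fun i z => f (inner ℝ z (y i))) fun i =>
    integrable_of_bounded_continuous (hf.comp (by fun_prop)) (fun z => h1 _) _]
  simp only [integral_comp_inner_stdGaussian hf]
  rw [← mean_const hn (∫ t, f t ∂(gaussianReal 0 (σ ^ 2).toNNReal)), ← mean_sub]
  have hm1 : mean (fun i => ‖y i‖ ^ 2 / σ ^ 2) = 1 := by
    have : (fun i => ‖y i‖ ^ 2 / σ ^ 2) = fun i => (σ ^ 2)⁻¹ * ‖y i‖ ^ 2 := by
      ext i
      rw [div_eq_inv_mul]
    rw [this, mean_const_mul, hy, inv_mul_cancel₀ (by positivity)]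
  calc _ ≤ mean (fun i => 3 / 2 * |‖y i‖ ^ 2 / σ ^ 2 - 1| +
        1 / 2 * (1 - ‖y i‖ ^ 2 / σ ^ 2)) := by
        refine (abs_mean_le _).trans (mean_le_mean fun i => ?_)
        have h := abs_integral_gaussianReal_sub_le_abs (a := ‖y i‖ ^ 2 / σ ^ 2) (v := σ ^ 2)
          hf.measurable h1 (by positivity) (by positivity)
        rw [div_mul_cancel₀ _ (by positivity)] at h
        linarith
    _ = 3 / 2 * mean (fun i => |‖y i‖ ^ 2 / σ ^ 2 - 1|) := by
        rw [mean_add, mean_const_mul, mean_const_mul, mean_sub, mean_const hn, hm1]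
        ring
    _ ≤ _ := by gcongr

end Deviation

/-! ### The deviation bound on the sphere and the conclusion. -/

theorem abs_mean_rescale_le {E : Type*} [NormedAddCommGroup E] [InnerProductSpace ℝ E] {n : ℕ}
    (x : Fin n → E) {B c : ℝ} (hB0 : 0 ≤ B)
    (hB : ∀ u, mean (fun i => inner ℝ u (x i) ^ 2) ≤ B * ‖u‖ ^ 2) {θ : E} (hθ : ‖θ‖ = 1)
    {f : ℝ → ℝ} (h2 : ∀ t u, |f t - f u| ≤ |t - u|) :
    |mean (fun i => f (inner ℝ θ (x i))) - mean (fun i => f (c * inner ℝ θ (x i)))| ≤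
      |c - 1| * √B := by
  rw [← mean_sub]
  calc _ ≤ mean (fun i => |c - 1| * |inner ℝ θ (x i)|) := by
        refine (abs_mean_le _).trans (mean_le_mean fun i => (h2 _ _).trans (le_of_eq ?_))
        rw [← abs_mul, abs_sub_comm]
        congr 1
        ring
    _ ≤ _ := by
        rw [mean_const_mul]
        have := mean_abs_inner_le hB0 hB θ
        rw [hθ, mul_one] at this
        gcongr

theorem mean_inner_sq_le_of_unitSphere {n d : ℕ} {x : Fin n → EuclideanSpace ℝ (Fin d)} {B : ℝ}
    (hB : ∀ θ : UnitSphere d, mean (fun i => inner ℝ θ.1 (x i) ^ 2) ≤ B)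
    (u : EuclideanSpace ℝ (Fin d)) : mean (fun i => inner ℝ u (x i) ^ 2) ≤ B * ‖u‖ ^ 2 := by
  rcases eq_or_ne u 0 with rfl | hu
  · simp [mean]
  have hu' : ‖u‖ ≠ 0 := norm_ne_zero_iff.2 hu
  have h := hB ⟨‖u‖⁻¹ • u, by simp [norm_smul, hu']⟩
  have e : mean (fun i => inner ℝ u (x i) ^ 2) =
      ‖u‖ ^ 2 * mean (fun i => inner ℝ (‖u‖⁻¹ • u) (x i) ^ 2) := by
    rw [← mean_const_mul]
    congr 1
    ext i
    rw [real_inner_smul_left]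
    field_simp
  rw [e, mul_comm]
  gcongr

/-- Sum the directional bound over the standard basis. This is what yields σ² ≤ B. -/
theorem mean_norm_sq_le {n d : ℕ} {x : Fin n → EuclideanSpace ℝ (Fin d)} {B : ℝ}
    (hB : ∀ u, mean (fun i => inner ℝ u (x i) ^ 2) ≤ B * ‖u‖ ^ 2) :
    mean (fun i => ‖x i‖ ^ 2) ≤ B * d := by
  have e : ∀ i, ‖x i‖ ^ 2 = ∑ j, inner ℝ (EuclideanSpace.single j (1 : ℝ)) (x i) ^ 2 := by
    intro i
    rw [EuclideanSpace.real_norm_sq_eq]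
    simp [EuclideanSpace.inner_single_left]
  simp only [e]
  rw [mean_finset_sum]
  calc _ ≤ ∑ _j : Fin d, B := Finset.sum_le_sum fun j _ => by simpa using hB (EuclideanSpace.single j 1)
    _ = B * d := by simp [mul_comm]

theorem mean_inner_sq_inv_sqrt_smul_le {n d : ℕ} (hd : 0 < d)
    {x : Fin n → EuclideanSpace ℝ (Fin d)} {B : ℝ}
    (hB : ∀ u, mean (fun i => inner ℝ u (x i) ^ 2) ≤ B * ‖u‖ ^ 2)
    (u : EuclideanSpace ℝ (Fin d)) :
    mean (fun i => inner ℝ u ((√(d : ℝ))⁻¹ • x i) ^ 2) ≤ B / d * ‖u‖ ^ 2 := by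
  have hsd : √(d : ℝ) ^ 2 = d := Real.sq_sqrt (Nat.cast_nonneg d)
  simp only [real_inner_smul_right, mul_pow, inv_pow, hsd]
  rw [mean_const_mul, div_mul_eq_mul_div, div_eq_inv_mul]
  exact mul_le_mul_of_nonneg_left (hB u) (by positivity)

/-- A Gaussian vector of typical length at which the smooth steps have about their typical means
has a direction whose projection is close to Gaussian. -/
theorem dBL_projMeasure_le_of_typical {n d : ℕ} (hn : 0 < n) (hd : 0 < d)
    (x : Fin n → EuclideanSpace ℝ (Fin d)) {σ A B ε R : ℝ} {N : ℕ} (hσ : 0 < σ)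
    (hx : mean (fun i => ‖x i‖ ^ 2) = σ ^ 2 * d)
    (hA : mean (fun i => |(σ ^ 2)⁻¹ * ‖x i‖ ^ 2 - d|) ≤ A)
    (hB : ∀ u, mean (fun i => inner ℝ u (x i) ^ 2) ≤ B * ‖u‖ ^ 2) (hσB : σ ^ 2 ≤ B)
    (hε0 : 0 < ε) (hεB : ε ≤ 2 * √B) (hAε : 2 * (A / d) ≤ ε)
    (hR0 : 0 < R) (hR2 : R ^ 2 * ε = 100 * B) (hN0 : 0 < N) (hN1 : 64 * R / ε ≤ N)
    {g : EuclideanSpace ℝ (Fin d)} {θ : UnitSphere d} (hg : g = ‖g‖ • θ.1)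
    (hg1 : |‖g‖ ^ 2 / d - 1| ≤ ε / (16 * √B))
    (hg2 : ∀ k < N, |mean (fun i => gridStep R N k (inner ℝ g ((√(d : ℝ))⁻¹ • x i))) -
        ∫ z, mean (fun i => gridStep R N k (inner ℝ z ((√(d : ℝ))⁻¹ • x i)))
          ∂(stdGaussian (EuclideanSpace ℝ (Fin d)))| ≤ ε / (32 * R)) :
    dBL (projMeasure x θ) (gaussianReal 0 (σ ^ 2).toNNReal) ≤ ENNReal.ofReal ε := by
  have hd' : (0 : ℝ) < d := by exact_mod_cast hd
  have hN0' : (0 : ℝ) < N := by exact_mod_cast hN0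
  have hB0 : 0 < B := lt_of_lt_of_le (by positivity) hσB
  have hsB0 : 0 < √B := Real.sqrt_pos.2 hB0
  have hsd : √(d : ℝ) ^ 2 = d := Real.sq_sqrt hd'.le
  have hyB := mean_inner_sq_inv_sqrt_smul_le hd hB
  set y : Fin n → EuclideanSpace ℝ (Fin d) := fun i => (√(d : ℝ))⁻¹ • x i with hy
  have hin : ∀ u i, inner ℝ u (y i) = (√(d : ℝ))⁻¹ * inner ℝ u (x i) := fun u i =>
    real_inner_smul_right _ _ _
  have hny : ∀ i, ‖y i‖ ^ 2 = (d : ℝ)⁻¹ * ‖x i‖ ^ 2 := by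
    intro i
    rw [hy, norm_smul, mul_pow, norm_inv, inv_pow, Real.norm_eq_abs, sq_abs, hsd]
  have hyσ : mean (fun i => ‖y i‖ ^ 2) = σ ^ 2 := by
    simp only [hny]
    rw [mean_const_mul, hx]
    field_simp
  have hyA : mean (fun i => |‖y i‖ ^ 2 / σ ^ 2 - 1|) ≤ A / d := by
    have e : ∀ i, |‖y i‖ ^ 2 / σ ^ 2 - 1| = (d : ℝ)⁻¹ * |(σ ^ 2)⁻¹ * ‖x i‖ ^ 2 - d| := by
      intro i
      rw [hny, ← abs_of_pos (inv_pos.2 hd'), ← abs_mul, abs_of_pos (inv_pos.2 hd')]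
      congr 1
      field_simp
    simp only [e]
    rw [mean_const_mul, div_eq_inv_mul]
    exact mul_le_mul_of_nonneg_left hA (by positivity)
  set τ := ε / (16 * √B) with hτ
  set η := ε / (32 * R) with hη
  have hτ1 : τ ≤ 1 := by
    rw [hτ, div_le_one (by positivity)]
    linarith
  refine dBL_projMeasure_le fun f h1 h2 => ?_
  set c := ‖g‖ / √(d : ℝ) with hc
  have hc0 : 0 ≤ c := by positivity
  have hc2 : ‖g‖ ^ 2 / d = c ^ 2 := by rw [hc, div_pow, hsd]
  rw [hc2] at hg1
  have hc1 : |c - 1| ≤ τ := by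
    refine le_trans ?_ hg1
    have : c ^ 2 - 1 = (c - 1) * (c + 1) := by ring
    rw [this, abs_mul]
    refine le_mul_of_one_le_right (abs_nonneg _) ?_
    rw [abs_of_nonneg (by linarith)]
    linarith
  have hgy : ∀ i, inner ℝ g (y i) = c * inner ℝ θ.1 (x i) := by
    intro i
    rw [hin, hg, real_inner_smul_left, hc]
    ring
  have ha := abs_mean_rescale_le x hB0.le hB (c := c) (norm_eq_of_mem_sphere θ) h2
  have hr : B / d * ‖g‖ ^ 2 ≤ 2 * B := by
    have : B / d * ‖g‖ ^ 2 = B * c ^ 2 := by rw [← hc2]; ring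
    rw [this]
    have := (abs_le.1 hg1).2
    nlinarith
  have hb := abs_mean_sub_integral_le (y := y) hn hR0 hN0 hyB (hyσ.trans_le hσB) hr hg2 h1 h2
  have he := abs_integral_mean_sub_gaussianReal_le hn y hσ hyσ hyA
    (continuous_of_abs_sub_le h2) h1
  simp only [hgy] at hb
  -- Error budget: ε/16 for rescaling, ε/16 for the mesh (counted twice), 6ε/100 for the tails
  -- beyond R, ε/16 for the steps, and 3ε/4 for the variance mixture; in all 0.9975 ε.
  have t1 : |c - 1| * √B ≤ ε / 16 := by
    calc |c - 1| * √B ≤ τ * √B := by gcongr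
      _ = ε / 16 := by rw [hτ]; field_simp
  have t2 : 2 * R / N ≤ ε / 32 := by
    rw [div_le_iff₀ hN0']
    rw [div_le_iff₀ hε0] at hN1
    linarith
  have t3 : 2 / R ^ 2 * (2 * B + B) ≤ ε * (6 / 100) := by
    rw [div_mul_eq_mul_div, div_le_iff₀ (by positivity)]
    linarith
  have t4 : 2 * R * η = ε / 16 := by
    rw [hη]
    field_simp
    norm_num
  rw [abs_le] at *
  constructor <;> linarith [ha.1, ha.2, hb.1, hb.2, he.1, he.2]

theorem stdGaussian_gridStep_tail {n d : ℕ} (hn : 0 < n) (hd : 0 < d)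
    {y : Fin n → EuclideanSpace ℝ (Fin d)} {B ε R : ℝ} {N : ℕ}
    (hB0 : 0 < B) (hε0 : 0 < ε) (hR0 : 0 < R) (hR2 : R ^ 2 * ε = 100 * B) (hN0 : 0 < N)
    (hN2 : N ≤ 65 * R / ε) (hyB : ∀ u, mean (fun i => inner ℝ u (y i) ^ 2) ≤ B / d * ‖u‖ ^ 2)
    (k : ℕ) :
    stdGaussian (EuclideanSpace ℝ (Fin d))
      {g | ε / (32 * R) < |mean (fun i => gridStep R N k (inner ℝ g (y i))) -
        ∫ z, mean (fun i => gridStep R N k (inner ℝ z (y i)))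
          ∂(stdGaussian (EuclideanSpace ℝ (Fin d)))|} ≤
      ENNReal.ofReal (2 * Real.exp (-(d * ε ^ 5 / (2163200000 * B ^ 2)))) := by
  have hd' : (0 : ℝ) < d := by exact_mod_cast hd
  have hN0' : (0 : ℝ) < N := by exact_mod_cast hN0
  have hδ0 : 0 < 2 * R / N := by positivity
  -- A step of slope at most 2, rescaled to width 2R/N, has slope at most N/R.
  have h := stdGaussian_mean_tail hn (b := B / d) (K := N / R) (η := ε / (32 * R)) (by positivity) hyB
    (h := gridStep R N k)
    (h' := fun t => smoothStepDeriv ((t - gridPoint R N k) / (2 * R / N)) * (1 / (2 * R / N)))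
    (fun t => by
      have h1 : HasDerivAt (fun t => (t - gridPoint R N k) / (2 * R / N)) (1 / (2 * R / N)) t :=
        ((hasDerivAt_id t).sub_const _).div_const _
      exact (hasDerivAt_smoothStep _).comp t h1)
    ((continuous_smoothStepDeriv.comp (by fun_prop)).mul continuous_const) (by positivity)
    (fun t => by
      rw [abs_mul, abs_of_pos (by positivity : 0 < 1 / (2 * R / (N : ℝ)))]
      calc _ ≤ 2 * (1 / (2 * R / (N : ℝ))) := by
            gcongr
            exact abs_smoothStepDeriv_le _
        _ = N / R := by field_simp)
    (fun t => abs_gridStep_le_one R N k t) (by positivity)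
  refine h.trans (ENNReal.ofReal_le_ofReal ?_)
  gcongr 2 * Real.exp (-?_)
  have hpi : Real.pi ^ 2 ≤ 10 := by
    have := Real.pi_lt_d2
    nlinarith [Real.pi_pos]
  -- Here N/R ≤ 65/ε, π² ≤ 10 and R² = 100B/ε give 2163200000 = 512 · 4225 · 1000.
  calc d * ε ^ 5 / (2163200000 * B ^ 2)
      = 2 * (ε / (32 * R)) ^ 2 / (10 * ((65 * R / ε / R) ^ 2 * (B / d))) := by
        have hBR : B = R ^ 2 * ε / 100 := by linarith
        rw [hBR]
        field_simp
        norm_num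
    _ ≤ 2 * (ε / (32 * R)) ^ 2 / (Real.pi ^ 2 * ((N / R) ^ 2 * (B / d))) := by gcongr

/-- The natural exponent is of order dε²/B; since ε³ ≤ 8B it beats the weaker exponent of the steps,
so both tails can be added. -/
theorem stdGaussian_norm_tail {d : ℕ} (hd : 0 < d) {B ε : ℝ} (hB0 : 0 < B) (hε0 : 0 < ε)
    (hεB : ε ≤ 2 * √B) (hε3 : ε ^ 3 ≤ 8 * B) :
    stdGaussian (EuclideanSpace ℝ (Fin d)) {g | ε / (16 * √B) < |‖g‖ ^ 2 / d - 1|} ≤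
      ENNReal.ofReal (2 * Real.exp (-(d * ε ^ 5 / (2163200000 * B ^ 2)))) := by
  have hd' : (0 : ℝ) < d := by exact_mod_cast hd
  have hsB : √B ^ 2 = B := Real.sq_sqrt hB0.le
  have hsB0 : 0 < √B := Real.sqrt_pos.2 hB0
  have hfr : (Module.finrank ℝ (EuclideanSpace ℝ (Fin d)) : ℝ) = d := by simp
  have h := stdGaussian_abs_norm_sq_tail (E := EuclideanSpace ℝ (Fin d)) (by simpa using hd)
    (τ := ε / (16 * √B)) (by positivity) (by rw [div_le_one (by positivity)]; linarith)
  rw [hfr] at h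
  refine h.trans (ENNReal.ofReal_le_ofReal ?_)
  gcongr 2 * Real.exp (-?_)
  rw [div_pow, mul_pow, hsB]
  rw [div_le_div_iff₀ (by positivity) (by positivity)]
  have e : d * (ε ^ 2 / (16 ^ 2 * B)) * (2163200000 * B ^ 2) = d * ε ^ 2 * B * 8450000 := by
    field_simp
    norm_num
  rw [e]
  have : d * ε ^ 2 * ε ^ 3 ≤ d * ε ^ 2 * (8 * B) := by gcongr
  have h0 : 0 ≤ d * ε ^ 2 * B := by positivity
  nlinarith

/-- Deviation bound for the bounded-Lipschitz distance between a random projection and the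
Gaussian law. -/
theorem uniformSphere_dBL_gt_le {n d : ℕ} (hn : 0 < n) (hd : 0 < d)
    (x : Fin n → EuclideanSpace ℝ (Fin d)) {σ A B ε : ℝ} (hσ : 0 < σ)
    (hx : mean (fun i => ‖x i‖ ^ 2) = σ ^ 2 * d)
    (hA : mean (fun i => |(σ ^ 2)⁻¹ * ‖x i‖ ^ 2 - d|) ≤ A)
    (hB : ∀ u, mean (fun i => inner ℝ u (x i) ^ 2) ≤ B * ‖u‖ ^ 2) (hσB : σ ^ 2 ≤ B)
    (hε0 : 0 < ε) (hε2 : ε < 2) (hεB : ε ^ 2 ≤ 4 * B) (hAε : 2 * (A / d) ≤ ε) :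
    uniformSphere d {θ : UnitSphere d | ENNReal.ofReal ε <
      dBL (projMeasure x θ) (gaussianReal 0 (σ ^ 2).toNNReal)} ≤
      ENNReal.ofReal (2600 * (√B / (ε * √ε)) * Real.exp (-(d * ε ^ 5 / (2163200000 * B ^ 2)))) := by
  have hd' : (0 : ℝ) < d := by exact_mod_cast hd
  have hB0 : 0 < B := by nlinarith
  have hsd : √(d : ℝ) ^ 2 = d := Real.sq_sqrt hd'.le
  have hsB : √B ^ 2 = B := Real.sq_sqrt hB0.le
  have hsε : √ε ^ 2 = ε := Real.sq_sqrt hε0.le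
  have hsd0 : 0 < √(d : ℝ) := Real.sqrt_pos.2 hd'
  have hsB0 : 0 < √B := Real.sqrt_pos.2 hB0
  have hsε0 : 0 < √ε := Real.sqrt_pos.2 hε0
  have hεsB : ε ≤ 2 * √B := abs_le_of_sq_le_sq' (by nlinarith) (by positivity) |>.2
  -- Chosen so that the tail term (2/R²)(2B + B) is 6ε/100.
  obtain ⟨R, hR⟩ : ∃ R, R = 10 * √B / √ε := ⟨_, rfl⟩
  have hR0 : 0 < R := by rw [hR]; positivity
  have hR2 : R ^ 2 * ε = 100 * B := by
    rw [hR, div_pow, mul_pow, hsB, hsε]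
    field_simp
    norm_num
  have hRε : 3 * ε ≤ R := by
    refine abs_le_of_sq_le_sq' ?_ hR0.le |>.2
    have : (3 * ε) ^ 2 * ε ≤ R ^ 2 * ε := by rw [hR2]; nlinarith [sq_nonneg ε]
    exact le_of_mul_le_mul_right this hε0
  obtain ⟨N, hN⟩ : ∃ N, N = ⌈64 * R / ε⌉₊ := ⟨_, rfl⟩
  have hN1 : 64 * R / ε ≤ N := by rw [hN]; exact Nat.le_ceil _
  have hN0' : (0 : ℝ) < N := lt_of_lt_of_le (by positivity) hN1
  have hN0 : 0 < N := by exact_mod_cast hN0'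
  have hN1' : (1 : ℝ) ≤ N := by exact_mod_cast hN0
  have hN2 : (N : ℝ) ≤ 65 * R / ε := by
    have h := (Nat.ceil_lt_add_one (show 0 ≤ 64 * R / ε by positivity)).le
    rw [← hN] at h
    have h1 : 1 ≤ R / ε := by
      rw [one_le_div hε0]
      linarith
    calc (N : ℝ) ≤ 64 * R / ε + R / ε := by linarith
      _ = 65 * R / ε := by ring
  set y : Fin n → EuclideanSpace ℝ (Fin d) := fun i => (√(d : ℝ))⁻¹ • x i with hy
  set γ := stdGaussian (EuclideanSpace ℝ (Fin d)) with hγ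
  set T1 : Set (EuclideanSpace ℝ (Fin d)) := {g | ε / (16 * √B) < |‖g‖ ^ 2 / d - 1|} with hT1
  set T2 : ℕ → Set (EuclideanSpace ℝ (Fin d)) := fun k =>
    {g | ε / (32 * R) < |mean (fun i => gridStep R N k (inner ℝ g (y i))) -
        ∫ z, mean (fun i => gridStep R N k (inner ℝ z (y i))) ∂γ|} with hT2
  have hmT1 : MeasurableSet T1 := measurableSet_lt measurable_const (by fun_prop)
  have hmT2 : ∀ k, MeasurableSet (T2 k) := by
    intro k
    refine measurableSet_lt measurable_const (Continuous.measurable ?_)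
    have := continuous_gridStep R N k
    simp only [mean]
    fun_prop
  have hmT : MeasurableSet (T1 ∪ ⋃ k ∈ Finset.range N, T2 k) :=
    hmT1.union (Finset.measurableSet_biUnion _ fun k _ => hmT2 k)
  -- the deterministic inclusion
  have hincl := uniformSphere_le_stdGaussian hd
    (measurableSet_dBL_projMeasure_gt x (gaussianReal 0 (σ ^ 2).toNNReal) (ENNReal.ofReal ε)) hmT
    (by
      intro g θ hθ hg
      by_contra hgT
      simp only [Set.mem_union, Set.mem_iUnion, not_or, not_exists, hT1, hT2, Set.mem_ofPred_eq,
        not_lt, Finset.mem_range] at hgT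
      exact not_le_of_gt hθ (dBL_projMeasure_le_of_typical hn hd x hσ hx hA hB hσB hε0 hεsB hAε
        hR0 hR2 hN0 hN1 hg hgT.1 hgT.2))
  set X := Real.exp (-(d * ε ^ 5 / (2163200000 * B ^ 2))) with hX
  have hε3 : ε ^ 3 ≤ 8 * B := by nlinarith
  have hp1 : γ T1 ≤ ENNReal.ofReal (2 * X) := stdGaussian_norm_tail hd hB0 hε0 hεsB hε3
  have hp2 : ∀ k, γ (T2 k) ≤ ENNReal.ofReal (2 * X) := fun k =>
    stdGaussian_gridStep_tail hn hd hB0 hε0 hR0 hR2 hN0 hN2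
      (mean_inner_sq_inv_sqrt_smul_le hd hB) k
  refine hincl.trans ((measure_union_le _ _).trans ?_)
  calc γ T1 + γ (⋃ k ∈ Finset.range N, T2 k)
      ≤ ENNReal.ofReal (2 * X) + ∑ k ∈ Finset.range N, ENNReal.ofReal (2 * X) :=
        add_le_add hp1 ((measure_biUnion_finset_le _ _).trans
          (Finset.sum_le_sum fun k _ => hp2 k))
    _ = ENNReal.ofReal ((1 + N) * (2 * X)) := by
        have hX0 : 0 < X := Real.exp_pos _
        rw [Finset.sum_const, Finset.card_range, nsmul_eq_mul, ← ENNReal.ofReal_natCast,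
          ← ENNReal.ofReal_mul (by positivity), ← ENNReal.ofReal_add (by positivity) (by positivity)]
        congr 1
        ring
    _ ≤ _ := by
        refine ENNReal.ofReal_le_ofReal ?_
        have hX0 : 0 < X := Real.exp_pos _
        -- The N + 1 events cost 2(1 + N) ≤ 4N, and N ≤ 65R/ε.
        have h4 : 4 * (N : ℝ) ≤ 2600 * (√B / (ε * √ε)) := by
          have e : 65 * R / ε = 650 * (√B / (ε * √ε)) := by
            rw [hR]
            field_simp
            norm_num
          linarith
        nlinarith

theorem corollary4 :
    ∃ c c' : ℝ, 0 < c ∧ 0 < c' ∧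
      ∀ (d n : ℕ) (_ : 2 ≤ d) (x : Fin n → EuclideanSpace ℝ (Fin d)) (σ A B ε : ℝ)
        (_ : 0 < σ)
        (_ : (1 / (n : ℝ)) * ∑ i, ‖x i‖ ^ 2 = σ ^ 2 * d)
        (_ : (1 / (n : ℝ)) * ∑ i, |(σ ^ 2)⁻¹ * ‖x i‖ ^ 2 - d| ≤ A)
        (_ : ∀ θ : UnitSphere d, (1 / (n : ℝ)) * ∑ i, (inner ℝ θ.1 (x i)) ^ 2 ≤ B)
        (_ : 2 * (A + 2) / ((d : ℝ) - 1) ≤ ε)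
        (Ω : Type*) [MeasurableSpace Ω] (P : Measure Ω) [IsProbabilityMeasure P]
        (θ : ℕ → Ω → UnitSphere d)
        (_ : ∀ j, Measurable (θ j))
        (_ : ∀ j, P.map (θ j) = uniformSphere d)
        (_ : iIndepFun θ P),
        ENNReal.ofReal
            (c * ε ^ (3 / 2 : ℝ) / √B * Real.exp (c' * ((d : ℝ) - 1) * ε ^ 5 / B ^ 2)) ≤
          ∫⁻ ω, (waitingTime x σ ε (fun j => θ j ω) : ℝ≥0∞) ∂P := by
  -- 10400 = 4 · 2600: the factor 4 is lost in passing to the expectation.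
  refine ⟨1 / 10400, 1 / 2163200000, by norm_num, by norm_num, ?_⟩
  intro d n hd x σ A B ε hσ hx hA hB hε Ω _ P _ θ hθ hlaw _
  have hd2 : (2 : ℝ) ≤ d := by exact_mod_cast hd
  have hn : 0 < n := by
    rcases Nat.eq_zero_or_pos n with rfl | hn
    · simp only [Nat.cast_zero, div_zero, zero_mul] at hx
      have : 0 < σ ^ 2 * d := by positivity
      linarith
    · exact hn
  have hBu := mean_inner_sq_le_of_unitSphere (x := x) (B := B) hB
  have hσB : σ ^ 2 ≤ B := by
    have h := mean_norm_sq_le hBu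
    rw [show mean (fun i => ‖x i‖ ^ 2) = σ ^ 2 * d from hx] at h
    exact le_of_mul_le_mul_right h (by linarith)
  have hB0 : 0 < B := lt_of_lt_of_le (by positivity) hσB
  have hsB0 : 0 < √B := Real.sqrt_pos.2 hB0
  have hA0 : 0 ≤ A := le_trans (mean_nonneg fun i => abs_nonneg _) hA
  have hε0 : 0 < ε := lt_of_lt_of_le (div_pos (by linarith) (by linarith)) hε
  have hsε0 : 0 < √ε := Real.sqrt_pos.2 hε0
  have h32 : ε ^ (3 / 2 : ℝ) = ε * √ε := by
    rw [Real.sqrt_eq_rpow, ← Real.rpow_one_add' hε0.le (by norm_num)]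
    norm_num
  rw [h32]
  obtain ⟨V, hV⟩ : ∃ V, V = 1 / 10400 * (ε * √ε) / √B *
    Real.exp (1 / 2163200000 * ((d : ℝ) - 1) * ε ^ 5 / B ^ 2) := ⟨_, rfl⟩
  have hV0 : 0 < V := by rw [hV]; positivity
  rw [← hV]
  suffices h : uniformSphere d {θ : UnitSphere d | ENNReal.ofReal ε <
      dBL (projMeasure x θ) (gaussianReal 0 (σ ^ 2).toNNReal)} ≤ ENNReal.ofReal (1 / (4 * V)) by
    have := le_lintegral_waitingTime x σ ε (by positivity) h P θ hθ hlaw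
    have e : 1 / (4 * (1 / (4 * V))) = V := by field_simp
    rwa [e] at this
  have hempty : (∀ θ : UnitSphere d, dBL (projMeasure x θ) (gaussianReal 0 (σ ^ 2).toNNReal) ≤
      ENNReal.ofReal ε) → uniformSphere d {θ : UnitSphere d | ENNReal.ofReal ε <
      dBL (projMeasure x θ) (gaussianReal 0 (σ ^ 2).toNNReal)} ≤ ENNReal.ofReal (1 / (4 * V)) := by
    intro h
    have : {θ : UnitSphere d | ENNReal.ofReal ε <
      dBL (projMeasure x θ) (gaussianReal 0 (σ ^ 2).toNNReal)} = ∅ := by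
      ext θ
      simpa using h θ
    rw [this, measure_empty]
    exact zero_le
  -- The deviation bound covers ε < 2 with ε² ≤ 4B. Outside this range no direction is bad.
  rcases le_or_gt 2 ε with hε2 | hε2
  · exact hempty fun θ => (dBL_projMeasure_le_two hn x θ _).trans (ENNReal.ofReal_le_ofReal hε2)
  rcases lt_or_ge (4 * B) (ε ^ 2) with hεB | hεB
  · refine hempty fun θ => (dBL_projMeasure_gaussianReal_le hn x θ _ (hB θ)).trans
      (ENNReal.ofReal_le_ofReal ?_)
    rw [Real.coe_toNNReal _ (by positivity)]
    have h1 : √(σ ^ 2) ≤ √B := Real.sqrt_le_sqrt hσB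
    have h2 : 2 * √B ≤ ε := by
      refine abs_le_of_sq_le_sq' ?_ hε0.le |>.2
      rw [mul_pow, Real.sq_sqrt hB0.le]
      linarith
    linarith
  have hAε : 2 * (A / d) ≤ ε := by
    refine le_trans ?_ hε
    rw [← mul_div_assoc]
    refine div_le_div₀ (by linarith) (by linarith) (by linarith) (by linarith)
  refine (uniformSphere_dBL_gt_le hn (by omega) x hσ hx hA hBu hσB hε0 hε2 hεB hAε).trans
    (ENNReal.ofReal_le_ofReal ?_)
  have e : 1 / (4 * V) = 2600 * (√B / (ε * √ε)) *
      Real.exp (-(1 / 2163200000 * ((d : ℝ) - 1) * ε ^ 5 / B ^ 2)) := by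
    rw [hV, Real.exp_neg]
    field_simp
    norm_num
  rw [e]
  gcongr ?_ * Real.exp (-?_)
  rw [div_le_div_iff₀ (by positivity) (by positivity)]
  have : ((d : ℝ) - 1) * (ε ^ 5 * B ^ 2) ≤ d * (ε ^ 5 * B ^ 2) := by
    gcongr
    linarith
  nlinarith
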